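/- Let $U,N\in\mathbb N$. A word $w=w[1]\cdots w[N]$ over the alphabet $\{\mathrm{ins}(a),\mathrm{ext}(a): a\in\{0,\dots,U\}\}\times\mathbb N$ is read as a sequence of insertions and extractions of items $a$ carrying timestamps $t$. Both the items $(a,t)$ and the values $a$ (with the timestamps forgotten) are kept in a multiset that is empty at the start: an insertion adds one copy and an extraction removes one copy. The word $w$ belongs to $\mathrm{PQ\text{-}TS}(U)$ if (i) each extracted item $(a,t)$ is in the multiset of stamped items at the moment of its extraction, and that multiset is empty at the end; (ii) each extracted value $a$ is a maximum of the multiset of values at the moment of its extraction; (iii) $w[i]=(\mathrm{ins}(a),t)$ implies $t=i$. A $p$-pass randomized streaming algorithm with memory $s$ for inputs of length $N$ reads the input $p$ times from left to right, letter by letter, using random coins and keeping $s$ bits of memory between letters; the input length is known in advance and the computation time is not restricted. It recognizes a language with bounded error $1/3$ if on every input of length $N$ its answer is wrong with probability at most $1/3$ over its coins. **Theorem.** There is a universal constant $c>0$ such that for every even $N$, every $p\ge 1$ and every $s$: if some $p$-pass randomized streaming algorithm with $s$ bits of memory recognizes $\mathrm{PQ\text{-}TS}(3N/2)$ with bounded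 error $1/3$ on inputs of length $N$, then $s\ge c\sqrt N/p$. That is, memory $\Omega(\sqrt N/p)$ is required. -/

import Mathlib

open MeasureTheory

/-- An operation on a container of items of type `α`: insertion or extraction of an item. -/
inductive Op (α : Type) : Type where
  | ins (a : α) : Op α
  | ext (a : α) : Op α

/-- The multiset `M_i` held after the first `i` operations of `w` (one copy of the item is added
by an insertion, one copy is removed by an extraction). -/
def contents {α : Type} [DecidableEq α] {N : ℕ} (w : Fin N → Op α) : ℕ → Multiset α
  | 0 => 0
  | i + 1 =>
    if h : i < N then
      match w ⟨i, h⟩ with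
      | Op.ins a => a ::ₘ contents w i
      | Op.ext a => (contents w i).erase a
    else contents w i

/-- The words of length `N` in `Collection(α)`. The letter `w i` (with `i` counted from `0`) acts
on `contents w i`. -/
def Collection (α : Type) [DecidableEq α] (N : ℕ) : Set (Fin N → Op α) :=
  {w | contents w N = 0 ∧ ∀ (i : Fin N) (a : α), w i = Op.ext a → a ∈ contents w i}

/-- The words of length `N` in `PQ(U)`: the items are `0, …, U`, and every extracted item is
a maximum of the current multiset. -/
def PQ (U N : ℕ) : Set (Fin N → Op (Fin (U + 1))) :=
  {w | w ∈ Collection (Fin (U + 1)) N ∧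
    ∀ (i : Fin N) (a : Fin (U + 1)), w i = Op.ext a → IsGreatest {b | b ∈ contents w i} a}

/-- The alphabet of `PQ-TS(U)`: an operation on an item of `{0, …, U}` with a timestamp. -/
abbrev StampedOp (U : ℕ) : Type := Op (Fin (U + 1)) × ℕ

/-- A stamped operation read as an operation on the stamped item `(a, t)`. -/
def StampedOp.toOp {U : ℕ} : StampedOp U → Op (Fin (U + 1) × ℕ)
  | (Op.ins a, t) => Op.ins (a, t)
  | (Op.ext a, t) => Op.ext (a, t)

/-- The words of length `N` in `PQ-TS(U)`. Timestamps count positions from `1`. -/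
def PQTS (U N : ℕ) : Set (Fin N → StampedOp U) :=
  {w | (fun i => (w i).toOp) ∈ Collection (Fin (U + 1) × ℕ) N ∧
    (fun i => (w i).1) ∈ PQ U N ∧
    ∀ (i : Fin N) (a : Fin (U + 1)), (w i).1 = Op.ins a → (w i).2 = (i : ℕ) + 1}

/-- A deterministic `p`-pass streaming algorithm for inputs of length `N` over the alphabet `A`,
with `s` bits of memory. All passes read the input from left to right. The input length, the
current pass and the current position are available free of charge, and the time per letter is not
restricted. -/
structure StreamingAlgorithm (A : Type) (N p s : ℕ) where
  /-- the memory after preprocessing -/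
  start : Fin s → Bool
  /-- the update of the memory in pass `j` when the letter at position `i` is read -/
  step : (j : Fin p) → (i : Fin N) → (Fin s → Bool) → A → (Fin s → Bool)
  /-- the answer computed from the memory after the last pass -/
  answer : (Fin s → Bool) → Bool

/-- The memory after pass `j` over `w`, started with memory `q`. -/
def StreamingAlgorithm.pass {A : Type} {N p s : ℕ} (M : StreamingAlgorithm A N p s)
    (w : Fin N → A) (j : Fin p) (q : Fin s → Bool) : Fin s → Bool :=
  Fin.foldl N (fun q i => M.step j i q (w i)) q

/-- The answer of the algorithm on `w`, after its `p` passes. -/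
def StreamingAlgorithm.output {A : Type} {N p s : ℕ} (M : StreamingAlgorithm A N p s)
    (w : Fin N → A) : Bool :=
  M.answer (Fin.foldl p (fun q j => M.pass w j q) M.start)

/-- A randomized `p`-pass streaming algorithm with `s` bits of memory: a random choice, by coins
`ω` in a probability space, of a deterministic one. The coins are not counted as memory; an
algorithm that tosses fresh coins at each letter is the special case in which the update at each
pass and position uses its own coordinate of `ω`. -/
structure RandomizedStreamingAlgorithm (A : Type) (N p s : ℕ) (Ω : Type*) [MeasurableSpace Ω] where
  /-- the law of the coins -/
  coins : ProbabilityMeasure Ω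
  /-- the algorithm that is run with given coins -/
  alg : Ω → StreamingAlgorithm A N p s
  /-- on each input, acceptance is an event -/
  measurable_output : ∀ w : Fin N → A, Measurable fun ω => (alg ω).output w

/-- The algorithm recognizes `L` with error at most `ε`: on every input, the probability over the
coins that the answer differs from membership in `L` is at most `ε`. -/
def RandomizedStreamingAlgorithm.Recognizes {A : Type} {N p s : ℕ} {Ω : Type*} [MeasurableSpace Ω]
    (R : RandomizedStreamingAlgorithm A N p s Ω) (L : Set (Fin N → A)) (ε : ℝ) : Prop :=
  ∀ w : Fin N → A,
    (R.coins : Measure Ω).real {ω | ¬ ((R.alg ω).output w = true ↔ w ∈ L)} ≤ ε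

/-!
The lower bound is an information argument about random inputs made of `m` blocks, each with a
string `x` of `n` bits, a position `k` and a check bit `z`. In the word of such an input
(`hardWord`), a block first inserts its letters, with values that increase with the block and the
position and leave room for the letter, then extracts the letters after position `k`, and then
inserts and extracts a check value that is a maximum unless `z` is set and the letter at `k` is
`true`. After all blocks, a tail extracts the remaining letters. All items come in two copies,
which keeps the length even and the slots uniform. The word belongs to the language if and only if
no block has its check bit set and a `true` letter at its position (`hardWord_mem`,
`hardWord_not_mem`). The tail depends only on the positions and on the strings up to the
positions, and not on check bits.

A transcript records the memory of each pass at the start of the tail and at the end of the pass.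
Under a guess of the transcript the `p` passes can run in parallel, as one pass with `p` times the
memory, and the guess is right if and only if it is confirmed
(`StreamingAlgorithm.blockProtocol_isExact`). This gives rectangles: consider inputs with the same
transcript, the same state in the middle of block `j`, and the same view of what the rest of the
blocks still reads. Exchanging the check bits from block `j` on between two of them changes none
of these (`BlockProtocol.cell_mix`). Hence, as in the cut-and-paste property of communication
complexity, the transcript separates the classes (letter, check bit) `= (0, 0)` and `(1, 1)` of
block `j`, of which one is to be accepted and the other to be rejected, only as well as it
separates the two valid classes `(0, 1)` and `(1, 0)`, in squared Hellinger distance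
(`BlockProtocol.cut_and_paste`). By the triangle inequality it then has to separate `(0, 0)` from
`(0, 1)` or from `(1, 0)`, and all of this takes place under the uniform law on valid inputs.

Neither is possible for most blocks if the memory is small. The transcript carries at most
`log |𝒯|` of information about all check bits (`BlockProtocol.sum_check_le`). About the letter at the
position of block `j`, there is information in the transcript, again at most `log |𝒯|` in total,
and in the state in the middle of the block. The latter is a message of `log |Q|` about a string,
written before the position is known, and so it informs on average about `log |Q| / n` of the
letter at a random position (`sum_indexDefect_le`, `BlockProtocol.sum_string_le`). Both bounds are
chain rules in the form `sum_sq_sqrt_condFreq_sub_le`: refining a conditioning moves conditional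
frequencies, in squared Hellinger distance, by at most the growth of `∑ p log p`.

Together `m` is at most of order `log |𝒯| + m log |Q| / n` (`BlockProtocol.blocks_le`). With `p`
passes and `s` bits, `log |𝒯|` and `log |Q|` are of order `ps`, and words of length `N` have room
for `m = n = ⌊√(N / 6)⌋`, so that `ps` is at least of order `√N`. The coins are fixed in advance
by averaging, and the words of length below `6` only require that `s ≠ 0`.
-/

/-! ### Conditional frequencies and squared Hellinger distances -/

section Frequency
open scoped Classical
open Finset

variable {Ξ κ κ' : Type*}

/-- The conditional frequency of the event `U`, given the value of `h` at `ω`: the proportion of `U`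
among the elements of `s` that have the same value of `h`. -/
noncomputable def condFreq (s U : Finset Ξ) (h : Ξ → κ) (ω : Ξ) : ℝ :=
  (#{ω' ∈ U | h ω' = h ω} : ℝ) / #{ω' ∈ s | h ω' = h ω}

/-- The sum over `s` of `p log p`, where `p` is the conditional frequency of `U` given `h`. It lies
between `-#s * negMulLog (#U / #s)` and `0`, and it grows when `h` is refined, for `U ⊆ s`. -/
noncomputable def freqEnt (s U : Finset Ξ) (h : Ξ → κ) : ℝ :=
  ∑ ω ∈ s, condFreq s U h ω * Real.log (condFreq s U h ω)

lemma condFreq_congr (s U : Finset Ξ) {h : Ξ → κ} {ω ω' : Ξ} (e : h ω = h ω') :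
    condFreq s U h ω = condFreq s U h ω' := by
  simp only [condFreq, e]

lemma condFreq_nonneg (s U : Finset Ξ) (h : Ξ → κ) (ω : Ξ) : 0 ≤ condFreq s U h ω := by
  unfold condFreq; positivity

lemma condFreq_le_one {s U : Finset Ξ} (hU : U ⊆ s) (h : Ξ → κ) (ω : Ξ) :
    condFreq s U h ω ≤ 1 := by
  unfold condFreq
  apply div_le_one_of_le₀ _ (by positivity)
  exact_mod_cast card_le_card (filter_subset_filter _ hU)

/-- The tower property: weighting a function of `h` by the conditional frequency of `U` given `h`
amounts to summing it over `U`. -/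
lemma sum_condFreq_mul {s U : Finset Ξ} (hU : U ⊆ s) (h : Ξ → κ) (F : Ξ → ℝ)
    (hF : F.FactorsThrough h) :
    ∑ ω ∈ s, condFreq s U h ω * F ω = ∑ ω ∈ U, F ω := by
  have h1 : ∀ ω ∈ s, condFreq s U h ω * F ω =
      ∑ ω' ∈ U, if h ω' = h ω then F ω' / #{ω'' ∈ s | h ω'' = h ω'} else 0 := by
    intro ω _
    rw [← sum_filter, condFreq]
    have : ∀ ω' ∈ ({ω' ∈ U | h ω' = h ω} : Finset Ξ),
        F ω' / #{ω'' ∈ s | h ω'' = h ω'} = F ω / #{ω'' ∈ s | h ω'' = h ω} := by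
      intro ω' hω'
      have e := (mem_filter.1 hω').2
      rw [hF e, e]
    rw [sum_congr rfl this, sum_const, nsmul_eq_mul]
    ring
  rw [sum_congr rfl h1, sum_comm]
  refine sum_congr rfl fun ω' hω' => ?_
  rw [← sum_filter, sum_const, nsmul_eq_mul]
  have e : ({ω ∈ s | h ω' = h ω} : Finset Ξ) = {ω ∈ s | h ω = h ω'} := by
    ext; simp [eq_comm]
  have hp : (0 : ℝ) < #{ω ∈ s | h ω = h ω'} := by
    have : ω' ∈ ({ω ∈ s | h ω = h ω'} : Finset Ξ) := mem_filter.2 ⟨hU hω', rfl⟩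
    exact_mod_cast card_pos.2 ⟨ω', this⟩
  rw [e]
  field_simp

lemma sum_condFreq {s U : Finset Ξ} (hU : U ⊆ s) (h : Ξ → κ) :
    ∑ ω ∈ s, condFreq s U h ω = #U := by
  simpa using sum_condFreq_mul hU h (fun _ => 1) (fun _ _ _ => rfl)

lemma condFreq_eq_zero_of_factorsThrough {s U : Finset Ξ} {g : Ξ → κ} {h : Ξ → κ'}
    (hgh : g.FactorsThrough h) {ω : Ξ} (hω : ω ∈ s)
    (h0 : condFreq s U g ω = 0) : condFreq s U h ω = 0 := by
  have hp : (0 : ℝ) < #{ω' ∈ s | g ω' = g ω} := by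
    have : ω ∈ ({ω' ∈ s | g ω' = g ω} : Finset Ξ) := mem_filter.2 ⟨hω, rfl⟩
    exact_mod_cast card_pos.2 ⟨ω, this⟩
  rw [condFreq, div_eq_zero_iff, or_iff_left hp.ne', Nat.cast_eq_zero, card_eq_zero,
    filter_eq_empty_iff] at h0
  rw [condFreq, div_eq_zero_iff]
  left
  rw [Nat.cast_eq_zero, card_eq_zero, filter_eq_empty_iff]
  intro ω' hω' e
  exact h0 hω' (hgh e)

/-- The pointwise bound of a squared Hellinger distance by a Kullback-Leibler divergence. Since
`log 0 = 0` here, the case `0 = q < p` has to be excluded. -/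
lemma sub_add_sq_sqrt_le_mul_log {p q : ℝ} (hp : 0 ≤ p) (hq : 0 ≤ q) (h : q = 0 → p = 0) :
    p - q + (√p - √q) ^ 2 ≤ p * Real.log p - p * Real.log q := by
  rcases hp.eq_or_lt with rfl | hp'
  · simp [Real.sq_sqrt hq]
  have hq' : 0 < q := lt_of_le_of_ne hq fun e => hp'.ne' (h e.symm)
  have sp := Real.sqrt_pos.2 hp'
  have sq := Real.sqrt_pos.2 hq'
  have e1 : Real.log p = 2 * Real.log √p := by
    rw [Real.log_sqrt hp]; ring
  have e2 : Real.log q = 2 * Real.log √q := by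
    rw [Real.log_sqrt hq]; ring
  have hl := Real.log_le_sub_one_of_pos (div_pos sq sp)
  rw [Real.log_div sq.ne' sp.ne'] at hl
  have h3 : √p * √p = p := Real.mul_self_sqrt hp
  have h4 : √q * √q = q := Real.mul_self_sqrt hq
  have h5 : p * (√q / √p - 1) = √p * √q - p := by
    field_simp
    rw [← h3]; simp; ring
  have h6 := mul_le_mul_of_nonneg_left hl hp
  rw [h5] at h6
  rw [e1, e2]
  nlinarith

/-- Refining the conditioning from `g` to `h` moves the conditional frequency of `U`, in squared
Hellinger distance, by at most the growth of `freqEnt`. -/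
lemma sum_sq_sqrt_condFreq_sub_le {s U : Finset Ξ} (hU : U ⊆ s) {g : Ξ → κ} {h : Ξ → κ'}
    (hgh : g.FactorsThrough h) :
    ∑ ω ∈ s, (√(condFreq s U h ω) - √(condFreq s U g ω)) ^ 2 ≤
      freqEnt s U h - freqEnt s U g := by
  have h1 : ∀ ω ∈ s, condFreq s U h ω - condFreq s U g ω +
      (√(condFreq s U h ω) - √(condFreq s U g ω)) ^ 2 ≤
      condFreq s U h ω * Real.log (condFreq s U h ω) -
        condFreq s U h ω * Real.log (condFreq s U g ω) := fun ω hω =>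
    sub_add_sq_sqrt_le_mul_log (condFreq_nonneg _ _ _ _) (condFreq_nonneg _ _ _ _)
      (condFreq_eq_zero_of_factorsThrough hgh hω)
  have h2 := sum_le_sum h1
  rw [sum_add_distrib, sum_sub_distrib, sum_sub_distrib, sum_condFreq hU, sum_condFreq hU,
    sum_condFreq_mul hU h (fun ω => Real.log (condFreq s U g ω))
      (fun a b e => by simp only; rw [condFreq_congr s U (hgh e)]),
    ← sum_condFreq_mul hU g (fun ω => Real.log (condFreq s U g ω))
      (fun a b e => by simp only; rw [condFreq_congr s U e])] at h2
  simpa [freqEnt] using h2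

lemma freqEnt_mono {s U : Finset Ξ} (hU : U ⊆ s) {g : Ξ → κ} {h : Ξ → κ'}
    (hgh : g.FactorsThrough h) : freqEnt s U g ≤ freqEnt s U h := by
  have := (sum_nonneg fun ω _ => sq_nonneg _).trans (sum_sq_sqrt_condFreq_sub_le hU hgh)
  linarith

lemma freqEnt_nonpos {s U : Finset Ξ} (hU : U ⊆ s) (h : Ξ → κ) : freqEnt s U h ≤ 0 :=
  sum_nonpos fun _ _ => mul_nonpos_of_nonneg_of_nonpos (condFreq_nonneg _ _ _ _)
    (Real.log_nonpos (condFreq_nonneg _ _ _ _) (condFreq_le_one hU _ _))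

lemma neg_freqEnt_le {s U : Finset Ξ} (hU : U ⊆ s) (h : Ξ → κ) :
    - freqEnt s U h ≤ #s * Real.negMulLog (#U / #s) := by
  have h1 := freqEnt_mono hU (g := fun _ => ()) (h := h) (fun _ _ _ => rfl)
  have h2 : freqEnt s U (fun _ => ()) = - (#s * Real.negMulLog (#U / #s)) := by
    simp [freqEnt, condFreq, Real.negMulLog]
  linarith

/-- The entropy of a function with values in `τ` is at most `log |τ|`. -/
lemma sum_negMulLog_le {τ : Type*} [Fintype τ] [DecidableEq τ] [Nonempty τ] (T : Ξ → τ)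
    (s : Finset Ξ) :
    ∑ t, (#s : ℝ) * Real.negMulLog (#{ω ∈ s | T ω = t} / #s) ≤ #s * Real.log (Fintype.card τ) := by
  rcases s.eq_empty_or_nonempty with rfl | hs
  · simp
  rw [← mul_sum]
  apply mul_le_mul_of_nonneg_left _ (by positivity)
  have hs' : (0 : ℝ) < #s := by exact_mod_cast card_pos.2 hs
  have hM : (0 : ℝ) < Fintype.card τ := by exact_mod_cast Fintype.card_pos
  have hsum : ∑ t, (#{ω ∈ s | T ω = t} : ℝ) / #s = 1 := by
    rw [← sum_div, ← Nat.cast_sum, ← card_eq_sum_card_fiberwise (f := T) (t := univ)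
      (fun _ _ => mem_coe.2 (mem_univ _))]
    exact div_self hs'.ne'
  have key : ∀ t, Real.negMulLog (#{ω ∈ s | T ω = t} / #s) ≤
      (#{ω ∈ s | T ω = t} : ℝ) / #s * Real.log (Fintype.card τ) +
        (1 / Fintype.card τ - (#{ω ∈ s | T ω = t} : ℝ) / #s) := by
    intro t
    set p := (#{ω ∈ s | T ω = t} : ℝ) / #s with hp
    have hp0 : 0 ≤ p := by positivity
    rcases hp0.eq_or_lt with h0 | h0
    · rw [← h0]; simp
    have := Real.log_le_sub_one_of_pos (show 0 < 1 / (Fintype.card τ * p) by positivity)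
    rw [Real.log_div one_ne_zero (by positivity), Real.log_one,
      Real.log_mul hM.ne' h0.ne'] at this
    have h2 := mul_le_mul_of_nonneg_left this h0.le
    have e : p * (1 / (Fintype.card τ * p) - 1) = 1 / Fintype.card τ - p := by
      field_simp
    rw [e] at h2
    rw [Real.negMulLog]
    linarith
  refine (sum_le_sum fun t _ => key t).trans_eq ?_
  rw [sum_add_distrib, ← sum_mul, sum_sub_distrib, hsum]
  simp

/-- Along a chain of successive refinements the squared Hellinger increments telescope. -/
lemma sum_chain_le {s U : Finset Ξ} (hU : U ⊆ s) (g : ℕ → Ξ → κ) (m : ℕ)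
    (hg : ∀ i < m, (g i).FactorsThrough (g (i + 1))) :
    ∑ i : Fin m, ∑ ω ∈ s, (√(condFreq s U (g (i + 1)) ω) - √(condFreq s U (g i) ω)) ^ 2 ≤
      #s * Real.negMulLog (#U / #s) := by
  have h1 := sum_le_sum fun (i : Fin m) (_ : i ∈ univ) =>
    sum_sq_sqrt_condFreq_sub_le hU (hg i i.2)
  rw [Fin.sum_univ_eq_sum_range (fun i => freqEnt s U (g (i + 1)) - freqEnt s U (g i)),
    sum_range_sub (fun i => freqEnt s U (g i))] at h1
  have h2 := neg_freqEnt_le hU (g 0)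
  have h3 := freqEnt_nonpos hU (g m)
  linarith

/-- A chain that is coarsened with growing `i`, where the step from `g i` to `g (i + 1)` passes
through `g₂ i` and then `g₁ i`; only the increments between `g₁ i` and `g₂ i` are counted. -/
lemma sum_chain_rev_le {κ₁ κ₂ : Type*} {s U : Finset Ξ} (hU : U ⊆ s) (g : ℕ → Ξ → κ) (m : ℕ)
    (g₁ : Fin m → Ξ → κ₁) (g₂ : Fin m → Ξ → κ₂)
    (h₁ : ∀ i : Fin m, (g (i + 1)).FactorsThrough (g₁ i))
    (h₁₂ : ∀ i, (g₁ i).FactorsThrough (g₂ i))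
    (h₂ : ∀ i : Fin m, (g₂ i).FactorsThrough (g i)) :
    ∑ i : Fin m, ∑ ω ∈ s, (√(condFreq s U (g₂ i) ω) - √(condFreq s U (g₁ i) ω)) ^ 2 ≤
      #s * Real.negMulLog (#U / #s) := by
  have h3 : ∀ i : Fin m, ∑ ω ∈ s, (√(condFreq s U (g₂ i) ω) - √(condFreq s U (g₁ i) ω)) ^ 2 ≤
      freqEnt s U (g i) - freqEnt s U (g (i + 1)) := by
    intro i
    have a := sum_sq_sqrt_condFreq_sub_le hU (h₁₂ i)
    have b := freqEnt_mono hU (h₁ i)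
    have c := freqEnt_mono hU (h₂ i)
    linarith
  have h1 := sum_le_sum fun (i : Fin m) (_ : i ∈ univ) => h3 i
  rw [Fin.sum_univ_eq_sum_range (fun i => freqEnt s U (g i) - freqEnt s U (g (i + 1))),
    sum_range_sub' (fun i => freqEnt s U (g i))] at h1
  have h2 := neg_freqEnt_le hU (g m)
  have h3 := freqEnt_nonpos hU (g 0)
  linarith

/-- The squared Hellinger distance of two measures decreases when atoms are merged. -/
lemma sq_sqrt_sum_sub_le {ι : Type*} (t : Finset ι) (a b : ι → ℝ) (ha : ∀ i, 0 ≤ a i)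
    (hb : ∀ i, 0 ≤ b i) :
    (√(∑ i ∈ t, a i) - √(∑ i ∈ t, b i)) ^ 2 ≤ ∑ i ∈ t, (√(a i) - √(b i)) ^ 2 := by
  have h1 := Real.sum_sqrt_mul_sqrt_le t ha hb
  have h2 : ∑ i ∈ t, (√(a i) - √(b i)) ^ 2 =
      ∑ i ∈ t, a i + ∑ i ∈ t, b i - 2 * ∑ i ∈ t, √(a i) * √(b i) := by
    rw [mul_sum, ← sum_add_distrib, ← sum_sub_distrib]
    refine sum_congr rfl fun i _ => ?_
    have := Real.sq_sqrt (ha i)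
    have := Real.sq_sqrt (hb i)
    nlinarith
  rw [h2]
  have := Real.sq_sqrt (sum_nonneg fun i (_ : i ∈ t) => ha i)
  have := Real.sq_sqrt (sum_nonneg fun i (_ : i ∈ t) => hb i)
  nlinarith

/-- The squared Hellinger distance between the image counts of `A` and `B` decreases when the map
`h` is replaced by a function `f` of it. -/
lemma sum_sq_sqrt_card_coarsen [Fintype κ] [DecidableEq κ] [Fintype κ'] [DecidableEq κ']
    (A B : Finset Ξ) (f : Ξ → κ) (h : Ξ → κ') (hf : f.FactorsThrough h) :
    ∑ c, (√(#{ω ∈ A | f ω = c}) - √(#{ω ∈ B | f ω = c})) ^ 2 ≤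
      ∑ c, (√(#{ω ∈ A | h ω = c}) - √(#{ω ∈ B | h ω = c})) ^ 2 := by
  rcases isEmpty_or_nonempty Ξ with hΞ | ⟨⟨ω₀⟩⟩
  · simp [eq_empty_of_isEmpty A, eq_empty_of_isEmpty B]
  obtain ⟨φ, hφ⟩ : ∃ φ : κ' → κ, ∀ ω, f ω = φ (h ω) :=
    ⟨Function.extend h f fun _ => f ω₀, fun ω => (hf.extend_apply _ ω).symm⟩
  have key : ∀ (A : Finset Ξ) (c : κ), (#{ω ∈ A | f ω = c} : ℝ) =
      ∑ c' with φ c' = c, (#{ω ∈ A | h ω = c'} : ℝ) := by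
    intro A c
    rw [← Nat.cast_sum, card_eq_sum_card_fiberwise (f := h) (t := ({c' | φ c' = c} : Finset κ'))]
    · congr 1
      refine sum_congr rfl fun c' hc' => ?_
      congr 1
      ext ω
      simp only [mem_filter, mem_univ, true_and] at hc' ⊢
      constructor
      · rintro ⟨⟨a, b⟩, c⟩; exact ⟨a, c⟩
      · rintro ⟨a, b⟩; exact ⟨⟨a, by rw [hφ, b, hc']⟩, b⟩
    · intro ω hω
      simp only [coe_filter, Set.mem_ofPred_eq, mem_univ, true_and] at hω ⊢
      rw [← hφ]; exact hω.2
  calc _ = ∑ c, (√(∑ c' with φ c' = c, (#{ω ∈ A | h ω = c'} : ℝ)) -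
        √(∑ c' with φ c' = c, (#{ω ∈ B | h ω = c'} : ℝ))) ^ 2 := by
        simp only [key]
    _ ≤ ∑ c, ∑ c' with φ c' = c, (√(#{ω ∈ A | h ω = c'}) - √(#{ω ∈ B | h ω = c'})) ^ 2 :=
        sum_le_sum fun c _ => sq_sqrt_sum_sub_le _ _ _ (fun _ => by positivity)
          (fun _ => by positivity)
    _ = _ := sum_fiberwise _ _ _

lemma sq_sqrt_mul_sub_le {W₀ W₁ p₀ p₁ q : ℝ} (hW₀ : 0 ≤ W₀) (hW₁ : 0 ≤ W₁) (hq : 0 ≤ q) :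
    (√(W₀ * p₀) - √(W₁ * p₁)) ^ 2 ≤
      3 * (W₀ * (√p₀ - √q) ^ 2 + W₁ * (√p₁ - √q) ^ 2 + q * (√W₀ - √W₁) ^ 2) := by
  rw [Real.sqrt_mul hW₀, Real.sqrt_mul hW₁]
  have e : √W₀ * √p₀ - √W₁ * √p₁ =
      √W₀ * (√p₀ - √q) - √W₁ * (√p₁ - √q) + √q * (√W₀ - √W₁) := by ring
  have h0 := Real.sq_sqrt hW₀
  have h1 := Real.sq_sqrt hW₁
  have h2 := Real.sq_sqrt hq
  have : 3 * (W₀ * (√p₀ - √q) ^ 2 + W₁ * (√p₁ - √q) ^ 2 + q * (√W₀ - √W₁) ^ 2) =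
      3 * ((√W₀ * (√p₀ - √q)) ^ 2 + (√W₁ * (√p₁ - √q)) ^ 2 + (√q * (√W₀ - √W₁)) ^ 2) := by
    rw [mul_pow, mul_pow, mul_pow, h0, h1, h2]
  rw [e, this]
  generalize √W₀ * (√p₀ - √q) = a
  generalize √W₁ * (√p₁ - √q) = b
  generalize √q * (√W₀ - √W₁) = c
  nlinarith [sq_nonneg (a + b), sq_nonneg (a - c), sq_nonneg (b + c)]

/-- The comparison of two classes `A false` and `A true` inside the event `U`, when `h` is `g`
together with the class. In a fibre of `g` the counts in `U` are the sizes `W y` of the classes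
times the conditional frequencies given `h`. These frequencies are close to the one given `g`, which
produces the Hellinger increment from `g` to `h`, and the `W y` are balanced up to the relative
defect `δ`. -/
lemma sum_sq_sqrt_card_class_le [DecidableEq Ξ] [Fintype κ] [DecidableEq κ] {s U : Finset Ξ}
    (hU : U ⊆ s) (g : Ξ → κ) (h : Ξ → κ') (A : Bool → Finset Ξ) (hA : ∀ y, A y ⊆ s)
    (hdisj : Disjoint (A false) (A true))
    (hfib : ∀ y, ∀ ω ∈ A y, ∀ ω' ∈ s, h ω' = h ω ↔ ω' ∈ A y ∧ g ω' = g ω)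
    (δ : Ξ → ℝ) (hδg : δ.FactorsThrough g)
    (hδ : ∀ y, ∀ ω ∈ A y, (√(#{ω' ∈ A false | g ω' = g ω}) - √(#{ω' ∈ A true | g ω' = g ω})) ^ 2 ≤
      δ ω * (#{ω' ∈ A false | g ω' = g ω} + #{ω' ∈ A true | g ω' = g ω})) :
    ∑ c, (√(#{ω ∈ A false | ω ∈ U ∧ g ω = c}) - √(#{ω ∈ A true | ω ∈ U ∧ g ω = c})) ^ 2 ≤
      3 * ∑ ω ∈ A false ∪ A true, ((√(condFreq s U h ω) - √(condFreq s U g ω)) ^ 2 +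
        condFreq s U g ω * δ ω) := by
  rw [← sum_fiberwise _ g, mul_sum]
  refine sum_le_sum fun c _ => ?_
  -- a fibre without elements of the two classes contributes nothing
  by_cases hne : ∃ y, ∃ ω ∈ A y, g ω = c
  swap
  · push Not at hne
    have : ∀ y, ({ω ∈ A y | ω ∈ U ∧ g ω = c} : Finset Ξ) = ∅ := fun y =>
      filter_eq_empty_iff.2 fun ω hω h => hne y ω hω h.2
    rw [this, this]
    simp only [card_empty, Nat.cast_zero, sub_self, ne_eq, OfNat.ofNat_ne_zero, not_false_eq_true,
      zero_pow]
    rw [filter_eq_empty_iff.2]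
    · simp
    · intro ω hω e
      rcases mem_union.1 hω with h1 | h1
      exacts [hne _ ω h1 e, hne _ ω h1 e]
  obtain ⟨y₀, ω₀, hω₀, rfl⟩ := hne
  set q := condFreq s U g ω₀ with hq
  set W : Bool → ℝ := fun y => #{ω' ∈ A y | g ω' = g ω₀} with hW
  set N : Bool → ℝ := fun y => #{ω ∈ A y | ω ∈ U ∧ g ω = g ω₀} with hN
  have hNW : ∀ y, N y = W y * (N y / W y) := by
    intro y
    by_cases h0 : W y = 0
    · have : N y ≤ W y := by
        simp only [hN, hW]
        exact_mod_cast card_le_card fun ω => by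
          simp only [mem_filter]; tauto
      have : 0 ≤ N y := by positivity
      rw [h0]; simp; linarith
    · field_simp
  have hp : ∀ y, ∀ ω ∈ ({ω ∈ A y | g ω = g ω₀} : Finset Ξ), condFreq s U h ω = N y / W y := by
    intro y ω hω
    obtain ⟨h1, h2⟩ := mem_filter.1 hω
    have e1 : ({ω' ∈ U | h ω' = h ω} : Finset Ξ) = {ω ∈ A y | ω ∈ U ∧ g ω = g ω₀} := by
      ext ω'
      simp only [mem_filter]
      constructor
      · rintro ⟨a, b⟩
        have := (hfib y ω h1 ω' (hU a)).1 b
        exact ⟨this.1, a, this.2.trans h2⟩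
      · rintro ⟨a, b, c⟩
        exact ⟨b, (hfib y ω h1 ω' (hU b)).2 ⟨a, c.trans h2.symm⟩⟩
    have e2 : ({ω' ∈ s | h ω' = h ω} : Finset Ξ) = {ω ∈ A y | g ω = g ω₀} := by
      ext ω'
      simp only [mem_filter]
      constructor
      · rintro ⟨a, b⟩
        have := (hfib y ω h1 ω' a).1 b
        exact ⟨this.1, this.2.trans h2⟩
      · rintro ⟨a, c⟩
        exact ⟨hA y a, (hfib y ω h1 ω' (hA y a)).2 ⟨a, c.trans h2.symm⟩⟩
    rw [condFreq, e1, e2]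
  have hsum : ∀ y, ∑ ω ∈ A y with g ω = g ω₀, ((√(condFreq s U h ω) - √(condFreq s U g ω)) ^ 2 +
        condFreq s U g ω * δ ω) = W y * ((√(N y / W y) - √q) ^ 2 + q * δ ω₀) := by
    intro y
    rw [sum_congr rfl (g := fun _ => (√(N y / W y) - √q) ^ 2 + q * δ ω₀), sum_const, nsmul_eq_mul]
    intro ω hω
    rw [hp y ω hω, condFreq_congr s U (mem_filter.1 hω).2, hδg (mem_filter.1 hω).2]
  rw [filter_union, sum_union (disjoint_filter_filter hdisj), hsum, hsum]
  have hmain := sq_sqrt_mul_sub_le (W₀ := W false) (W₁ := W true) (p₀ := N false / W false)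
    (p₁ := N true / W true) (q := q) (Nat.cast_nonneg _) (Nat.cast_nonneg _)
    (condFreq_nonneg _ _ _ _)
  rw [← hNW, ← hNW] at hmain
  refine hmain.trans ?_
  have h2 : q * (√(W false) - √(W true)) ^ 2 ≤ q * (δ ω₀ * (W false + W true)) :=
    mul_le_mul_of_nonneg_left (hδ y₀ ω₀ hω₀) (condFreq_nonneg s U g ω₀)
  nlinarith

end Frequency

/-! ### The index problem: one message about a uniform string -/

section Index
open scoped Classical
open Finset

/-- The number of strings with the same message `α x` as `x`, the same letters after position `k`,
and the letter `y` at position `k`. -/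
noncomputable def indexCount {n : ℕ} {Q : Type*} (α : (Fin n → Bool) → Q) (k : Fin n)
    (x : Fin n → Bool) (y : Bool) : ℕ :=
  #{x' | (∀ i, k < i → x' i = x i) ∧ x' k = y ∧ α x' = α x}

/-- How far the letter at position `k` is from being balanced, once the message `α x` and the later
letters are known: a relative squared Hellinger distance in `[0, 1]`. It is never `0 / 0`, since `x`
itself is counted. -/
noncomputable def indexDefect {n : ℕ} {Q : Type*} (α : (Fin n → Bool) → Q) (k : Fin n)
    (x : Fin n → Bool) : ℝ :=
  (√(indexCount α k x false) - √(indexCount α k x true)) ^ 2 /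
    (indexCount α k x false + indexCount α k x true)

variable {n : ℕ} {Q : Type*}

lemma indexDefect_nonneg (α : (Fin n → Bool) → Q) (k : Fin n) (x : Fin n → Bool) :
    0 ≤ indexDefect α k x := by
  unfold indexDefect; positivity

lemma indexDefect_le_one (α : (Fin n → Bool) → Q) (k : Fin n) (x : Fin n → Bool) :
    indexDefect α k x ≤ 1 := by
  unfold indexDefect
  apply div_le_one_of_le₀ _ (by positivity)
  have h0 := Real.sq_sqrt (Nat.cast_nonneg (α := ℝ) (indexCount α k x false))
  have h1 := Real.sq_sqrt (Nat.cast_nonneg (α := ℝ) (indexCount α k x true))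
  have := mul_nonneg (Real.sqrt_nonneg (indexCount α k x false : ℝ))
    (Real.sqrt_nonneg (indexCount α k x true : ℝ))
  nlinarith

lemma indexDefect_mul (α : (Fin n → Bool) → Q) (k : Fin n) (x : Fin n → Bool) :
    indexDefect α k x * (indexCount α k x false + indexCount α k x true) =
      (√(indexCount α k x false) - √(indexCount α k x true)) ^ 2 := by
  unfold indexDefect
  by_cases h : (indexCount α k x false + indexCount α k x true : ℝ) = 0
  · have h0 : (0 : ℝ) ≤ indexCount α k x false := by positivity
    have h1 : (0 : ℝ) ≤ indexCount α k x true := by positivity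
    have e0 : (indexCount α k x false : ℝ) = 0 := by linarith
    have e1 : (indexCount α k x true : ℝ) = 0 := by linarith
    simp [e0, e1]
  · field_simp

lemma indexCount_congr {α α' : (Fin n → Bool) → Q} {k : Fin n} {x x' : Fin n → Bool}
    (hα : α = α') (hx : ∀ i, k < i → x i = x' i) (ha : α x = α' x') :
    indexCount α k x = indexCount α' k x' := by
  subst hα
  funext y
  unfold indexCount
  congr 1
  ext w
  simp only [mem_filter, mem_univ, true_and, ha]
  constructor
  · rintro ⟨h1, h2⟩; exact ⟨fun i hi => (h1 i hi).trans (hx i hi), h2⟩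
  · rintro ⟨h1, h2⟩; exact ⟨fun i hi => (h1 i hi).trans (hx i hi).symm, h2⟩

lemma indexDefect_congr {α α' : (Fin n → Bool) → Q} {k : Fin n} {x x' : Fin n → Bool}
    (hα : α = α') (hx : ∀ i, k < i → x i = x' i) (ha : α x = α' x') :
    indexDefect α k x = indexDefect α' k x' := by
  simp only [indexDefect, indexCount_congr hα hx ha]

/-- The suffix of a string from position `t` on, the letters before `t` being replaced by `false`.
-/
def suffixFrom (t : ℕ) (x : Fin n → Bool) : Fin n → Bool := fun i => decide (t ≤ i) && x i

lemma suffixFrom_eq_iff {t : ℕ} {x x' : Fin n → Bool} :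
    suffixFrom t x = suffixFrom t x' ↔ ∀ i : Fin n, t ≤ i → x i = x' i := by
  simp only [suffixFrom, funext_iff]
  refine forall_congr' fun i => ?_
  by_cases h : t ≤ (i : ℕ) <;> simp [h]

/-- A message from `Q` about a uniform string of length `n` unbalances its letters by at most
`3 log |Q|` in total. For each message the suffixes of the string form a chain, and the positions without
conditioning on the message are perfectly balanced, so only the increments of the chain count. -/
theorem sum_indexDefect_le [Fintype Q] [Nonempty Q] (α : (Fin n → Bool) → Q) :
    ∑ k, ∑ x, indexDefect α k x ≤ 3 * (2 ^ n * Real.log (Fintype.card Q)) := by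
  have key : ∀ (a : Q) (k : Fin n), ∑ x with α x = a, indexDefect α k x ≤
      3 * ∑ x, (√(condFreq univ ({x | α x = a} : Finset _) (suffixFrom k) x) -
        √(condFreq univ ({x | α x = a} : Finset _) (suffixFrom (k + 1)) x)) ^ 2 := by
    intro a k
    set U : Finset (Fin n → Bool) := {x | α x = a} with hU
    set A : Bool → Finset (Fin n → Bool) := fun y => {x | x k = y} with hA
    have hW : ∀ c, #{x ∈ A false | suffixFrom (k + 1) x = c} =
        #{x ∈ A true | suffixFrom (k + 1) x = c} := by
      intro c
      have hs : ∀ (x : Fin n → Bool) b, suffixFrom (k + 1) (Function.update x k b) =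
          suffixFrom (k + 1) x := fun x b => suffixFrom_eq_iff.2 fun i hi => by
        rw [Function.update_of_ne]; rintro rfl; omega
      refine card_nbij' (fun x => Function.update x k true) (fun x => Function.update x k false)
        ?_ ?_ ?_ ?_
      · intro x; simp [hA, hs]
      · intro x; simp [hA, hs]
      · intro x hx
        have : x k = false := by simpa [hA] using (mem_filter.1 hx).1
        simp [← this]
      · intro x hx
        have : x k = true := by simpa [hA] using (mem_filter.1 hx).1
        simp [← this]
    have h1 := sum_sq_sqrt_card_class_le (subset_univ U) (suffixFrom (k + 1)) (suffixFrom k) A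
      (fun _ => subset_univ _)
      (disjoint_left.2 fun x h0 h1 => by simp [hA] at h0 h1; simp [h0] at h1)
      (by
        intro y x hx x' _
        simp only [suffixFrom_eq_iff, hA, mem_filter, mem_univ, true_and] at hx ⊢
        constructor
        · intro h
          exact ⟨(h k le_rfl).trans hx, fun i hi => h i (by omega)⟩
        · rintro ⟨h0, h1⟩ i hi
          rcases hi.eq_or_lt with e | e
          · rw [← Fin.ext e, h0, hx]
          · exact h1 i e)
      (fun _ => 0) (fun _ _ _ => rfl) (by intro y x _; rw [hW]; simp)
    have h2 : A false ∪ A true = univ := by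
      ext x; simp [hA]
    rw [h2] at h1
    simp only [mul_zero, add_zero] at h1
    refine le_trans (le_of_eq ?_) h1
    rw [← sum_fiberwise _ (suffixFrom (k + 1))]
    refine sum_congr rfl fun c _ => ?_
    by_cases hne : ∃ x, α x = a ∧ suffixFrom (k + 1) x = c
    swap
    · have e : ∀ y, ({x ∈ A y | x ∈ U ∧ suffixFrom (k + 1) x = c} : Finset _) = ∅ := fun y =>
        filter_eq_empty_iff.2 fun x _ h => hne ⟨x, by simpa [hU] using h.1, h.2⟩
      rw [e, e, filter_eq_empty_iff.2]
      · simp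
      · intro x hx h; exact hne ⟨x, by simpa [hU] using hx, h⟩
    obtain ⟨x₀, ha, rfl⟩ := hne
    have hR : ∀ y, #{x ∈ A y | x ∈ U ∧ suffixFrom (k + 1) x = suffixFrom (k + 1) x₀} =
        indexCount α k x₀ y := by
      intro y
      unfold indexCount
      congr 1
      ext x
      simp only [hA, hU, mem_filter, mem_univ, true_and, suffixFrom_eq_iff, ha]
      constructor
      · rintro ⟨h1, h2, h3⟩; exact ⟨fun i hi => h3 i hi, h1, h2⟩
      · rintro ⟨h3, h1, h2⟩; exact ⟨h1, h2, fun i hi => h3 i hi⟩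
    rw [hR, hR, ← indexDefect_mul, sum_congr rfl (g := fun _ => indexDefect α k x₀), sum_const,
      nsmul_eq_mul, mul_comm]
    · congr 1
      rw [← hR, ← hR, ← Nat.cast_add, ← card_union_of_disjoint]
      · congr 2
        ext x
        simp only [hU, hA, mem_filter, mem_union, mem_univ, true_and]
        cases x k <;> simp
      · rw [disjoint_left]
        intro x h0 h1
        simp [hA] at h0 h1; simp [h0] at h1
    · intro x hx
      obtain ⟨hx1, hx2⟩ := mem_filter.1 hx
      refine indexDefect_congr rfl (fun i hi => (suffixFrom_eq_iff.1 hx2) i hi) ?_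
      rw [ha]; simpa [hU] using hx1
  calc ∑ k, ∑ x, indexDefect α k x = ∑ a, ∑ k, ∑ x with α x = a, indexDefect α k x := by
        rw [sum_comm (s := univ (α := Q))]
        exact sum_congr rfl fun k _ => (sum_fiberwise _ _ _).symm
    _ ≤ ∑ a, 3 * (#(univ : Finset (Fin n → Bool)) *
          Real.negMulLog (#{x | α x = a} / #(univ : Finset (Fin n → Bool)))) := by
        refine sum_le_sum fun a _ => ?_
        refine (sum_le_sum fun k _ => key a k).trans ?_
        rw [← mul_sum]
        apply mul_le_mul_of_nonneg_left _ (by norm_num)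
        refine sum_chain_rev_le (subset_univ _) (suffixFrom (n := n)) n
          (fun k => suffixFrom (k + 1)) (fun k => suffixFrom k) (fun _ _ _ h => h) ?_
          (fun _ _ _ h => h)
        intro k x x' h
        rw [suffixFrom_eq_iff] at h ⊢
        exact fun i hi => h i (by omega)
    _ ≤ _ := by
        rw [← mul_sum]
        apply mul_le_mul_of_nonneg_left _ (by norm_num)
        refine (sum_negMulLog_le α univ).trans_eq ?_
        simp

end Index

/-! ### Blocks and block protocols -/

/-- One block of a hard input: a string, a position in it, and a bit that says whether the letter at
this position is tested. -/
@[ext]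
structure Block (n : ℕ) where
  /-- the string -/
  x : Fin n → Bool
  /-- the position that may be tested -/
  k : Fin n
  /-- the check bit -/
  z : Bool

namespace Block

variable {n : ℕ}

/-- The block as a triple. -/
def equivProd (n : ℕ) : Block n ≃ (Fin n → Bool) × Fin n × Bool where
  toFun b := (b.x, b.k, b.z)
  invFun p := ⟨p.1, p.2.1, p.2.2⟩
  left_inv _ := rfl
  right_inv _ := rfl

instance : Fintype (Block n) := Fintype.ofEquiv _ (equivProd n).symm

instance : DecidableEq (Block n) := (equivProd n).decidableEq

/-- A block is good unless its check bit is set and the letter at its position is `true`. -/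
def Good (b : Block n) : Prop := ¬ (b.z = true ∧ b.x b.k = true)

instance : DecidablePred (Good (n := n)) := fun b => by unfold Good; infer_instance

/-- The block with the letter at its position and its check bit replaced. -/
def set (b : Block n) (y z : Bool) : Block n := ⟨Function.update b.x b.k y, b.k, z⟩

/-- The finite set of good blocks. -/
def good (n : ℕ) : Finset (Block n) := {b | b.Good}

end Block

section Blocks
open scoped Classical
open Finset

variable {m n : ℕ}

/-- The inputs all of whose blocks are good. -/
def validInputs (m n : ℕ) : Finset (Fin m → Block n) := {ξ | ∀ i, (ξ i).Good}

/-- The inputs whose blocks other than block `j` are good, and whose block `j` has the letter `y` at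
its position and the check bit `z`. They are valid unless `y` and `z` are both `true`. -/
def inputClass (j : Fin m) (y z : Bool) : Finset (Fin m → Block n) :=
  {ξ | (∀ i, i ≠ j → (ξ i).Good) ∧ (ξ j).x (ξ j).k = y ∧ (ξ j).z = z}

lemma mem_validInputs {ξ : Fin m → Block n} : ξ ∈ validInputs m n ↔ ∀ i, (ξ i).Good := by
  simp [validInputs]

lemma mem_inputClass {j : Fin m} {y z : Bool} {ξ : Fin m → Block n} :
    ξ ∈ inputClass j y z ↔
      (∀ i, i ≠ j → (ξ i).Good) ∧ (ξ j).x (ξ j).k = y ∧ (ξ j).z = z := by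
  simp [inputClass]

lemma inputClass_subset {j : Fin m} {y z : Bool} (h : ¬ (z = true ∧ y = true)) :
    inputClass j y z ⊆ validInputs m n := by
  intro ξ hξ
  rw [mem_inputClass] at hξ
  rw [mem_validInputs]
  intro i
  by_cases e : i = j
  · subst e
    rw [Block.Good, hξ.2.1, hξ.2.2]; exact h
  · exact hξ.1 i e

/-- The four classes of one block have the same size: replace the letter and the check bit. -/
lemma card_inputClass (j : Fin m) (y z y' z' : Bool) :
    #(inputClass (n := n) j y z) = #(inputClass (n := n) j y' z') := by
  have key : ∀ y z y' z', ∀ ξ ∈ inputClass (n := n) j y z,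
      Function.update ξ j ((ξ j).set y' z') ∈ inputClass (n := n) j y' z' ∧
      Function.update (Function.update ξ j ((ξ j).set y' z')) j
        ((Function.update ξ j ((ξ j).set y' z') j).set y z) = ξ := by
    intro y z y' z' ξ hξ
    rw [mem_inputClass] at hξ ⊢
    refine ⟨⟨fun i hi => by rw [Function.update_of_ne hi]; exact hξ.1 i hi, ?_, ?_⟩, ?_⟩
    · simp [Block.set]
    · simp [Block.set]
    · funext i
      by_cases e : i = j
      · subst e
        simp only [Block.set, Function.update_self, Function.update_idem]
        rw [← hξ.2.1, ← hξ.2.2]; simp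
      · simp [e]
  exact card_nbij' (fun ξ => Function.update ξ j ((ξ j).set y' z'))
    (fun ξ => Function.update ξ j ((ξ j).set y z))
    (fun ξ hξ => (key y z y' z' ξ hξ).1) (fun ξ hξ => (key y' z' y z ξ hξ).1)
    (fun ξ hξ => (key y z y' z' ξ hξ).2) (fun ξ hξ => (key y' z' y z ξ hξ).2)

lemma card_validInputs_le (j : Fin m) :
    #(validInputs m n) ≤ 3 * #(inputClass (n := n) j false false) := by
  have h : validInputs m n ⊆
      inputClass j false false ∪ inputClass j false true ∪ inputClass j true false := by
    intro ξ hξ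
    rw [mem_validInputs] at hξ
    have hj := hξ j
    simp only [mem_union, mem_inputClass]
    rw [Block.Good] at hj
    have h1 : ∀ i, i ≠ j → (ξ i).Good := fun i _ => hξ i
    cases hz : (ξ j).z <;> cases hy : (ξ j).x (ξ j).k <;> simp_all
  have := (card_le_card h).trans ((card_union_le _ _).trans
    (Nat.add_le_add_right (card_union_le _ _) _))
  rw [card_inputClass j false true false false, card_inputClass j true false false false] at this
  omega

/-- The valid inputs form a product, so that block `j` can be drawn afresh. -/
lemma card_good_mul_sum (j : Fin m) (F : (Fin m → Block n) → ℝ) :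
    #(Block.good n) * ∑ ξ ∈ validInputs m n, F ξ =
      ∑ ξ ∈ validInputs m n, ∑ b ∈ Block.good n, F (Function.update ξ j b) := by
  have h0 : #(Block.good n) * ∑ ξ ∈ validInputs m n, F ξ =
      ∑ p ∈ validInputs m n ×ˢ Block.good n, F p.1 := by
    simp [sum_product, mul_sum]
  rw [h0, ← sum_product']
  have key : ∀ p ∈ validInputs m n ×ˢ Block.good n,
      (Function.update p.1 j p.2, p.1 j) ∈ validInputs m n ×ˢ Block.good n := by
    rintro ⟨ξ, b⟩ hp
    simp only [mem_product, mem_validInputs, Block.good, mem_filter, mem_univ, true_and] at hp ⊢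
    refine ⟨fun i => ?_, hp.1 j⟩
    by_cases e : i = j
    · subst e; simpa using hp.2
    · simpa [e] using hp.1 i
  refine sum_nbij' (fun p => (Function.update p.1 j p.2, p.1 j))
    (fun p => (Function.update p.1 j p.2, p.1 j)) key key ?_ ?_ ?_
  · rintro ⟨ξ, b⟩ _; simp
  · rintro ⟨ξ, b⟩ _; simp
  · rintro ⟨ξ, b⟩ _; simp

/-- Under the uniform law on valid inputs, an event that does not depend on block `j` is independent
of block `j`. -/
lemma card_filter_mul_card_good (j : Fin m) (P : (Fin m → Block n) → Prop) (q : Block n → Prop)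
    (hP : ∀ ξ b, P (Function.update ξ j b) ↔ P ξ) :
    (#(Block.good n) : ℝ) * #{ξ ∈ validInputs m n | P ξ ∧ q (ξ j)} =
      #{ξ ∈ validInputs m n | P ξ} * #{b ∈ Block.good n | q b} := by
  have h := card_good_mul_sum (n := n) j (fun ξ => if P ξ ∧ q (ξ j) then 1 else 0)
  rw [sum_boole] at h
  rw [h]
  have : ∀ ξ ∈ validInputs m n, (∑ b ∈ Block.good n,
      if P (Function.update ξ j b) ∧ q (Function.update ξ j b j) then (1 : ℝ) else 0) =
      if P ξ then (#{b ∈ Block.good n | q b} : ℝ) else 0 := by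
    intro ξ _
    simp only [hP, Function.update_self]
    by_cases hp : P ξ <;> simp [hp]
  rw [sum_congr rfl this, ← sum_filter, sum_const, nsmul_eq_mul]

/-- A partial view of the input: all positions, the letter at `a` in block `i` with position `k` if
`mx i k a`, and the check bit of block `i` if `mz i`. Hidden bits are replaced by `false`. -/
noncomputable def view (mx : Fin m → Fin n → Fin n → Prop) (mz : Fin m → Prop)
    (ξ : Fin m → Block n) :
    Fin m → Fin n × (Fin n → Bool) × Bool :=
  fun i => ((ξ i).k, fun a => decide (mx i (ξ i).k a) && (ξ i).x a, decide (mz i) && (ξ i).z)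

lemma view_eq_iff {mx : Fin m → Fin n → Fin n → Prop} {mz : Fin m → Prop}
    {ξ ξ' : Fin m → Block n} :
    view mx mz ξ = view mx mz ξ' ↔ ∀ i, (ξ i).k = (ξ' i).k ∧
      (∀ a, mx i (ξ i).k a → (ξ i).x a = (ξ' i).x a) ∧ (mz i → (ξ i).z = (ξ' i).z) := by
  simp only [view, funext_iff, Prod.mk.injEq]
  refine forall_congr' fun i => and_congr_right fun hk => and_congr (forall_congr' fun a => ?_) ?_
  · rw [← hk]
    by_cases h : mx i (ξ i).k a <;> simp [h]
  · by_cases h : mz i <;> simp [h]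

/-- A one-way protocol on `m` blocks with states `Q`, which runs under a guess `τ` of the
transcript. For each block the string is fed to the state, and then the block is queried, where only
the part of the string after the position, the position and the check bit are seen. The guess is
confirmed by the last state and by a condition `tail` on the part of the input that the queries do
not see: the strings up to their positions. For several passes over the input, `Q` holds the
memories of all passes at the same place of the input, and the guess links the end of one pass to
the start of the next. -/
structure BlockProtocol (m n : ℕ) (Q 𝒯 : Type*) where
  /-- the first state under a guess of the transcript -/
  start : 𝒯 → Q
  /-- the state after the last block that confirms the guess -/
  final : 𝒯 → Q
  /-- the update by the string of a block -/
  feed : Fin m → Q → (Fin n → Bool) → Q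
  /-- the update by the query of a block -/
  query : Fin m → Q → Block n → Q
  /-- the query sees the position, the check bit and the string after the position -/
  query_congr : ∀ j q {b b' : Block n}, b.k = b'.k → b.z = b'.z →
    (∀ i, b.k < i → b.x i = b'.x i) → query j q b = query j q b'
  /-- the condition on the rest of the word that confirms the guess -/
  tail : 𝒯 → (Fin m → Block n) → Prop
  /-- the rest of the word shows the positions and the strings up to their positions -/
  tail_congr : ∀ τ {ξ ξ' : Fin m → Block n}, (∀ j, (ξ j).k = (ξ' j).k) →
    (∀ j, ∀ i ≤ (ξ j).k, (ξ j).x i = (ξ' j).x i) → tail τ ξ → tail τ ξ'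
  /-- the true transcript -/
  transcript : (Fin m → Block n) → 𝒯

namespace BlockProtocol

variable {Q 𝒯 : Type*} (P : BlockProtocol m n Q 𝒯)

/-- The state after the first `i` blocks, under the guess `τ`. -/
def state (τ : 𝒯) (ξ : Fin m → Block n) : ℕ → Q
  | 0 => P.start τ
  | i + 1 => if h : i < m then
      P.query ⟨i, h⟩ (P.feed ⟨i, h⟩ (state τ ξ i) (ξ ⟨i, h⟩).x) (ξ ⟨i, h⟩) else state τ ξ i

/-- The state between the feeding and the query of block `j`, under the guess `τ`. -/
def mid (τ : 𝒯) (ξ : Fin m → Block n) (j : Fin m) : Q :=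
  P.feed j (P.state τ ξ j) (ξ j).x

lemma state_succ (τ : 𝒯) (ξ : Fin m → Block n) (j : Fin m) :
    P.state τ ξ (j + 1) = P.query j (P.mid τ ξ j) (ξ j) := by
  rw [state, dif_pos j.2, mid]

lemma state_congr (τ : 𝒯) {ξ ξ' : Fin m → Block n} {i : ℕ}
    (h : ∀ l : Fin m, (l : ℕ) < i → ξ l = ξ' l) : P.state τ ξ i = P.state τ ξ' i := by
  induction i with
  | zero => rfl
  | succ i ih =>
    have ih' := ih fun l hl => h l (by omega)
    simp only [state, ih']
    split_ifs with hi
    · rw [h ⟨i, hi⟩ (by simp)]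
    · rfl

lemma state_eq_of_le (τ : 𝒯) {ξ ξ' : Fin m → Block n} {i t : ℕ} (hit : i ≤ t)
    (h0 : P.state τ ξ i = P.state τ ξ' i)
    (h : ∀ l : Fin m, i ≤ (l : ℕ) → ξ l = ξ' l) : P.state τ ξ t = P.state τ ξ' t := by
  induction t, hit using Nat.le_induction with
  | base => exact h0
  | succ t hit ih =>
    simp only [state, ih]
    split_ifs with hi
    · rw [h ⟨t, hi⟩ hit]
    · rfl

/-- A guess is the true transcript if and only if it is confirmed. -/
def IsExact : Prop := ∀ ξ τ, P.transcript ξ = τ ↔ P.state τ ξ m = P.final τ ∧ P.tail τ ξ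

/-- The cell of an input with respect to block `j`: its transcript, the state in the middle of block
`j`, all positions, the strings after their positions, the full strings after block `j`, and the
check bits before block `j`. The cells are rectangles, see `cell_mix`. -/
noncomputable def cell (j : Fin m) (ξ : Fin m → Block n) :
    𝒯 × Q × (Fin m → Fin n × (Fin n → Bool) × Bool) :=
  (P.transcript ξ, P.mid (P.transcript ξ) ξ j,
    view (fun i k a => k < a ∨ j < i) (fun i => i < j) ξ)

/-- The input with the strings and positions of `ξ`, the check bits of `ξ` before block `j`, and the
check bits of `ξ'` from block `j` on. -/
def mix (j : Fin m) (ξ ξ' : Fin m → Block n) : Fin m → Block n :=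
  fun i => ⟨(ξ i).x, (ξ i).k, if j ≤ i then (ξ' i).z else (ξ i).z⟩

lemma mix_mix (j : Fin m) (ξ ξ' : Fin m → Block n) : mix j (mix j ξ ξ') (mix j ξ' ξ) = ξ := by
  funext i
  simp only [mix]
  split_ifs <;> rfl

variable {P}

/-- The rectangle property. Up to the middle of block `j` the mixed input is `ξ`. From the query of
block `j` on it looks like `ξ'` to the protocol, since the two share the middle state, the positions
and all strings that are still read. The tail does not see check bits. Hence the guess is confirmed.
-/
lemma cell_mix (hP : P.IsExact) {j : Fin m} {ξ ξ' : Fin m → Block n}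
    (h : P.cell j ξ = P.cell j ξ') : P.cell j (mix j ξ ξ') = P.cell j ξ := by
  simp only [cell, Prod.mk.injEq, view_eq_iff] at h
  obtain ⟨hT, hmid, hv⟩ := h
  set τ := P.transcript ξ with hτ
  rw [← hT] at hmid
  have hs : ∀ l : Fin m, (l : ℕ) < j → mix j ξ ξ' l = ξ l := by
    intro l hl
    have : ¬ j ≤ l := by simpa using hl
    simp [mix, this]
  have hstate : P.state τ (mix j ξ ξ') j = P.state τ ξ j := P.state_congr τ hs
  have hmid' : P.mid τ (mix j ξ ξ') j = P.mid τ ξ j := by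
    rw [mid, hstate]; rfl
  have hnext : P.state τ (mix j ξ ξ') (j + 1) = P.state τ ξ' (j + 1) := by
    rw [state_succ, state_succ, hmid', hmid]
    refine P.query_congr _ _ (hv j).1 (by simp [mix]) fun i hi => (hv j).2.1 i (Or.inl hi)
  have hfinal : P.state τ (mix j ξ ξ') m = P.state τ ξ' m := by
    refine P.state_eq_of_le τ (Nat.succ_le_of_lt j.2) hnext fun l hl => ?_
    have hjl : j < l := Nat.lt_of_succ_le hl
    refine Block.ext (funext fun a => (hv l).2.1 a (Or.inr hjl)) (hv l).1 ?_
    simp [mix, hjl.le]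
  have hT' : P.transcript (mix j ξ ξ') = τ := by
    rw [hP, hfinal]
    refine ⟨((hP _ _).1 hT.symm).1, ?_⟩
    exact P.tail_congr τ (ξ := ξ) (fun _ => rfl) (fun _ _ _ => rfl) ((hP ξ τ).1 rfl).2
  simp only [cell, Prod.mk.injEq, view_eq_iff]
  refine ⟨hT', by rw [hT', hmid'], fun i => ⟨rfl, fun _ _ => rfl, fun hi => ?_⟩⟩
  rw [hs i hi]

lemma mix_mem {j : Fin m} {y y' z z' : Bool} {ξ ξ' : Fin m → Block n}
    (hξ : ξ ∈ inputClass j y z) (hξ' : ξ' ∈ inputClass j y' z')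
    (hv : ∀ i, j < i → (ξ i).k = (ξ' i).k ∧ (ξ i).x = (ξ' i).x) :
    mix j ξ ξ' ∈ inputClass j y z' := by
  rw [mem_inputClass] at hξ hξ' ⊢
  refine ⟨fun i hi => ?_, hξ.2.1, by simpa [mix] using hξ'.2.2⟩
  rcases lt_or_gt_of_ne hi with h | h
  · have : ¬ j ≤ i := not_le.2 h
    have e : mix j ξ ξ' i = ξ i := by simp [mix, this]
    rw [e]; exact hξ.1 i hi
  · have e : mix j ξ ξ' i = ξ' i := by
      refine Block.ext (hv i h).2 (hv i h).1 (by simp [mix, h.le])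
    rw [e]; exact hξ'.1 i hi

/-- Within a cell, exchanging the check bits from block `j` on maps pairs of inputs with (letter,
check bit) equal to `(0, 0)` and `(1, 1)` bijectively to pairs with `(0, 1)` and `(1, 0)`. -/
lemma card_cell_mul (hP : P.IsExact) (j : Fin m)
    (c : 𝒯 × Q × (Fin m → Fin n × (Fin n → Bool) × Bool)) :
    #{ξ ∈ inputClass j false false | P.cell j ξ = c} *
      #{ξ ∈ inputClass j true true | P.cell j ξ = c} =
    #{ξ ∈ inputClass j false true | P.cell j ξ = c} *
      #{ξ ∈ inputClass j true false | P.cell j ξ = c} := by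
  rw [← card_product, ← card_product]
  have hv : ∀ {ξ ξ' : Fin m → Block n}, P.cell j ξ = c → P.cell j ξ' = c →
      ∀ i, j < i → (ξ i).k = (ξ' i).k ∧ (ξ i).x = (ξ' i).x := by
    intro ξ ξ' h h' i hi
    have := h.trans h'.symm
    simp only [cell, Prod.mk.injEq, view_eq_iff] at this
    exact ⟨(this.2.2 i).1, funext fun a => (this.2.2 i).2.1 a (Or.inr hi)⟩
  have key : ∀ z z', ∀ p ∈ ({ξ ∈ inputClass j false z | P.cell j ξ = c} ×ˢ
      {ξ ∈ inputClass j true z' | P.cell j ξ = c} : Finset ((Fin m → Block n) × _)),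
      (mix j p.1 p.2, mix j p.2 p.1) ∈ ({ξ ∈ inputClass j false z' | P.cell j ξ = c} ×ˢ
      {ξ ∈ inputClass j true z | P.cell j ξ = c} : Finset ((Fin m → Block n) × _)) := by
    rintro z z' ⟨ξ, ξ'⟩ hp
    simp only [mem_product, mem_filter] at hp ⊢
    obtain ⟨⟨h1, h2⟩, h3, h4⟩ := hp
    exact ⟨⟨mix_mem h1 h3 (hv h2 h4), (cell_mix hP (h2.trans h4.symm)).trans h2⟩,
      mix_mem h3 h1 (hv h4 h2), (cell_mix hP (h4.trans h2.symm)).trans h4⟩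
  refine card_nbij' (fun p => (mix j p.1 p.2, mix j p.2 p.1))
    (fun p => (mix j p.1 p.2, mix j p.2 p.1)) (key _ _) (key _ _) ?_ ?_
  · rintro ⟨ξ, ξ'⟩ _; simp [mix_mix]
  · rintro ⟨ξ, ξ'⟩ _; simp [mix_mix]

variable [Fintype 𝒯] [Fintype Q]

/-- The squared Hellinger distance in terms of the affinity. -/
lemma sum_sq_sqrt_eq {ι : Type*} [Fintype ι] (a b : ι → ℕ) :
    ∑ c, (√(a c) - √(b c)) ^ 2 = (∑ c, a c : ℕ) + (∑ c, b c : ℕ) - 2 * ∑ c, √(a c * b c : ℕ) := by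
  push_cast
  rw [mul_sum, ← sum_add_distrib, ← sum_sub_distrib]
  refine sum_congr rfl fun c _ => ?_
  have h1 := Real.sq_sqrt (Nat.cast_nonneg (α := ℝ) (a c))
  have h2 := Real.sq_sqrt (Nat.cast_nonneg (α := ℝ) (b c))
  rw [Real.sqrt_mul (Nat.cast_nonneg _)]
  nlinarith

lemma sum_card_cell (j : Fin m) (A : Finset (Fin m → Block n)) :
    ∑ c, #{ξ ∈ A | P.cell j ξ = c} = #A :=
  (card_eq_sum_card_fiberwise (f := P.cell j) (t := univ) fun _ _ => mem_coe.2 (mem_univ _)).symm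

/-- The cut-and-paste property: the cells are as far apart on the classes `(0, 0)` and `(1, 1)`, of
which the second is invalid, as on the two valid classes `(0, 1)` and `(1, 0)`. -/
lemma cut_and_paste (hP : P.IsExact) (j : Fin m) :
    ∑ c, (√(#{ξ ∈ inputClass j false false | P.cell j ξ = c}) -
      √(#{ξ ∈ inputClass j true true | P.cell j ξ = c})) ^ 2 =
    ∑ c, (√(#{ξ ∈ inputClass j false true | P.cell j ξ = c}) -
      √(#{ξ ∈ inputClass j true false | P.cell j ξ = c})) ^ 2 := by
  rw [sum_sq_sqrt_eq, sum_sq_sqrt_eq]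
  simp only [card_cell_mul hP, sum_card_cell]
  rw [card_inputClass j false true false false, card_inputClass j true false false false,
    card_inputClass j true true false false]

end BlockProtocol
end Blocks

/-! ### The information about the check bits -/

section CheckBits
open scoped Classical
open Finset

variable {m n : ℕ}

namespace BlockProtocol

variable {Q 𝒯 : Type*} (P : BlockProtocol m n Q 𝒯)

/-- The valid inputs with transcript `τ`. -/
noncomputable def event (τ : 𝒯) : Finset (Fin m → Block n) :=
  {ξ ∈ validInputs m n | P.transcript ξ = τ}

lemma event_subset (τ : 𝒯) : P.event τ ⊆ validInputs m n := filter_subset _ _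

lemma filter_event {κ : Type*} [DecidableEq κ]
    {A : Finset (Fin m → Block n)} (hA : A ⊆ validInputs m n)
    (g : 𝒯 → (Fin m → Block n) → κ) (τ : 𝒯) (d : κ) :
    ({ξ ∈ A | (P.transcript ξ, g (P.transcript ξ) ξ) = (τ, d)} : Finset _) =
      {ξ ∈ A | ξ ∈ P.event τ ∧ g τ ξ = d} := by
  ext ξ
  simp only [mem_filter, Prod.mk.injEq, event]
  constructor
  · rintro ⟨h1, rfl, h2⟩; exact ⟨h1, ⟨hA h1, rfl⟩, h2⟩
  · rintro ⟨h1, ⟨_, rfl⟩, h2⟩; exact ⟨h1, rfl, h2⟩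

lemma sum_event_negMulLog [Fintype 𝒯] [Nonempty 𝒯] :
    ∑ τ, (#(validInputs m n) : ℝ) *
      Real.negMulLog (#(P.event τ) / #(validInputs m n)) ≤
    #(validInputs m n) * Real.log (Fintype.card 𝒯) :=
  sum_negMulLog_le P.transcript (validInputs m n)

/-- All positions and strings, and the first `i` check bits. -/
noncomputable def checkView (i : ℕ) : (Fin m → Block n) → (Fin m → Fin n × (Fin n → Bool) × Bool) :=
  view (fun _ _ _ => True) (fun l => (l : ℕ) < i)

lemma checkView_eq_iff {i : ℕ} {ξ ξ' : Fin m → Block n} : checkView i ξ = checkView i ξ' ↔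
    ∀ l, (ξ l).k = (ξ' l).k ∧ (ξ l).x = (ξ' l).x ∧ ((l : ℕ) < i → (ξ l).z = (ξ' l).z) := by
  rw [checkView, view_eq_iff]
  simp only [true_imp_iff, funext_iff]

lemma checkView_update {j : Fin m} (ξ : Fin m → Block n) (z : Bool) :
    checkView j (Function.update ξ j ⟨(ξ j).x, (ξ j).k, z⟩) = checkView j ξ := by
  rw [checkView_eq_iff]
  intro l
  by_cases e : l = j
  · subst e; simp
  · simp [e]

/-- Without the transcript, the check bit of block `j` is balanced given the rest of the view. -/
lemma card_checkView (j : Fin m) (y : Bool) (d : Fin m → Fin n × (Fin n → Bool) × Bool) :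
    #{ξ ∈ inputClass j y false | checkView j ξ = d} =
      #{ξ ∈ inputClass j y true | checkView j ξ = d} := by
  have key : ∀ z z', ∀ ξ ∈ ({ξ ∈ inputClass j y z | checkView j ξ = d} : Finset _),
      Function.update ξ j ⟨(ξ j).x, (ξ j).k, z'⟩ ∈
        ({ξ ∈ inputClass j y z' | checkView j ξ = d} : Finset _) ∧
      Function.update (Function.update ξ j ⟨(ξ j).x, (ξ j).k, z'⟩) j
        ⟨(Function.update ξ j ⟨(ξ j).x, (ξ j).k, z'⟩ j).x,
          (Function.update ξ j ⟨(ξ j).x, (ξ j).k, z'⟩ j).k, z⟩ = ξ := by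
    intro z z' ξ hξ
    simp only [mem_filter, mem_inputClass, checkView_update] at hξ ⊢
    refine ⟨⟨⟨fun i hi => by simpa [hi] using hξ.1.1 i hi, by simpa using hξ.1.2.1, by simp⟩,
      hξ.2⟩, ?_⟩
    have := hξ.1.2.2
    subst this
    simp
  exact card_nbij' (fun ξ => Function.update ξ j ⟨(ξ j).x, (ξ j).k, true⟩)
    (fun ξ => Function.update ξ j ⟨(ξ j).x, (ξ j).k, false⟩)
    (fun ξ hξ => (key _ _ ξ hξ).1) (fun ξ hξ => (key _ _ ξ hξ).1)
    (fun ξ hξ => (key _ _ ξ hξ).2) (fun ξ hξ => (key _ _ ξ hξ).2)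

/-- The view at the start of block `i`: the state, the positions, the check bits, the strings from
block `i` on, and the part of the earlier strings after their positions. It loses information when
`i` grows. -/
noncomputable def stringView (τ : 𝒯) (i : ℕ) (ξ : Fin m → Block n) :
    Q × (Fin m → Fin n × (Fin n → Bool) × Bool) :=
  (P.state τ ξ i, view (fun l k a => k < a ∨ i ≤ l) (fun _ => True) ξ)

/-- The view in the middle of block `j`: the two last states, the positions, the check bits, the
strings after block `j`, and the part of the other strings after their positions. -/
noncomputable def midView (τ : 𝒯) (j : Fin m) (ξ : Fin m → Block n) :
    Q × Q × (Fin m → Fin n × (Fin n → Bool) × Bool) :=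
  (P.state τ ξ j, P.mid τ ξ j, view (fun l k a => k < a ∨ j < l) (fun _ => True) ξ)

/-- The view in the middle of block `j`, with the letter at its position added. -/
noncomputable def bitView (τ : 𝒯) (j : Fin m) (ξ : Fin m → Block n) :
    Bool × Q × Q × (Fin m → Fin n × (Fin n → Bool) × Bool) :=
  ((ξ j).x (ξ j).k, P.midView τ j ξ)

/-- The imbalance of the letter at the position of block `j`, for the message that consists of the
state in the middle of block `j`. -/
noncomputable def defect (τ : 𝒯) (j : Fin m) (ξ : Fin m → Block n) : ℝ :=
  indexDefect (P.feed j (P.state τ ξ j)) (ξ j).k (ξ j).x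

lemma midView_eq_iff {τ : 𝒯} {j : Fin m} {ξ ξ' : Fin m → Block n} :
    P.midView τ j ξ = P.midView τ j ξ' ↔ P.state τ ξ j = P.state τ ξ' j ∧
      P.mid τ ξ j = P.mid τ ξ' j ∧ ∀ i, (ξ i).k = (ξ' i).k ∧
      (∀ a, (ξ i).k < a ∨ j < i → (ξ i).x a = (ξ' i).x a) ∧ (ξ i).z = (ξ' i).z := by
  simp only [midView, Prod.mk.injEq, view_eq_iff, true_imp_iff]

variable [Fintype 𝒯] [Fintype Q]

/-- The transcript reveals little about the check bits, even if all strings are known: on average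
over the blocks the check bit `0` or `1` changes the law of the cell by at most `log |𝒯| / m`, up to
a factor. -/
lemma sum_check_le [Nonempty 𝒯] :
    ∑ j, ∑ c, (√(#{ξ ∈ inputClass j false false | P.cell j ξ = c}) -
      √(#{ξ ∈ inputClass j false true | P.cell j ξ = c})) ^ 2 ≤
    3 * (#(validInputs m n) * Real.log (Fintype.card 𝒯)) := by
  have key : ∀ j : Fin m, ∑ c, (√(#{ξ ∈ inputClass j false false | P.cell j ξ = c}) -
      √(#{ξ ∈ inputClass j false true | P.cell j ξ = c})) ^ 2 ≤
      ∑ τ, 3 * ∑ ξ ∈ validInputs m n,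
        (√(condFreq (validInputs m n) (P.event τ) (checkView (j + 1)) ξ) -
        √(condFreq (validInputs m n) (P.event τ) (checkView j) ξ)) ^ 2 := by
    intro j
    have hsub : ∀ z, inputClass (n := n) j false z ⊆ validInputs m n :=
      fun z => inputClass_subset (by simp)
    refine (sum_sq_sqrt_card_coarsen _ _ (P.cell j)
      (fun ξ => (P.transcript ξ, checkView j ξ)) ?_).trans ?_
    · intro ξ ξ' h
      simp only [Prod.mk.injEq, checkView_eq_iff] at h
      obtain ⟨hT, hv⟩ := h
      simp only [cell, Prod.mk.injEq, view_eq_iff, ← hT, true_and]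
      refine ⟨?_, fun i => ⟨(hv i).1, fun a _ => by rw [(hv i).2.1], (hv i).2.2⟩⟩
      rw [mid, mid, (hv j).2.1, P.state_congr]
      intro l hl
      exact Block.ext (hv l).2.1 (hv l).1 ((hv l).2.2 hl)
    · rw [Fintype.sum_prod_type]
      refine sum_le_sum fun τ _ => ?_
      simp only [fun z d => P.filter_event (hsub z) (fun _ => checkView j) τ d]
      refine (sum_sq_sqrt_card_class_le (P.event_subset τ) (checkView j) (checkView (j + 1))
        (fun z => inputClass j false z) hsub ?_ ?_ (fun _ => 0) (fun _ _ _ => rfl) ?_).trans ?_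
      · rw [disjoint_left]
        intro ξ h0 h1
        rw [mem_inputClass] at h0 h1
        simp [h0.2.2] at h1
      · intro z ξ hξ ξ' hξ'
        rw [mem_inputClass] at hξ
        rw [mem_validInputs] at hξ'
        simp only [checkView_eq_iff, mem_inputClass]
        constructor
        · intro h
          refine ⟨⟨fun i _ => hξ' i, ?_, ?_⟩, fun l => ⟨(h l).1, (h l).2.1, fun hl =>
            (h l).2.2 (by omega)⟩⟩
          · rw [(h j).1, (h j).2.1]; exact hξ.2.1
          · rw [(h j).2.2 (by omega)]; exact hξ.2.2
        · rintro ⟨h1, h2⟩ l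
          refine ⟨(h2 l).1, (h2 l).2.1, fun hl => ?_⟩
          rcases (Nat.lt_succ_iff.1 hl).eq_or_lt with e | e
          · rw [Fin.ext e, h1.2.2, hξ.2.2]
          · exact (h2 l).2.2 e
      · intro z ξ _
        rw [card_checkView]; simp
      · simp only [mul_zero, add_zero]
        apply mul_le_mul_of_nonneg_left _ (by norm_num)
        exact sum_le_sum_of_subset_of_nonneg (union_subset (hsub _) (hsub _))
          fun _ _ _ => sq_nonneg _
  refine (sum_le_sum fun j _ => key j).trans ?_
  rw [sum_comm]
  refine le_trans ?_ (mul_le_mul_of_nonneg_left P.sum_event_negMulLog (by norm_num))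
  rw [mul_sum]
  refine sum_le_sum fun τ _ => ?_
  rw [← mul_sum]
  apply mul_le_mul_of_nonneg_left _ (by norm_num)
  refine sum_chain_le (P.event_subset τ) checkView m fun i _ ξ ξ' h => ?_
  rw [checkView_eq_iff] at h ⊢
  exact fun l => ⟨(h l).1, (h l).2.1, fun hl => (h l).2.2 (by omega)⟩

end BlockProtocol
end CheckBits

/-! ### The information about the tested letters -/

section Strings
open scoped Classical
open Finset

variable {m n : ℕ}

/-- The sum over all blocks of a function of string and position; the factor `2` is the check bit.
-/
lemma sum_block {F : (Fin n → Bool) → Fin n → ℝ} :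
    ∑ b : Block n, F b.x b.k = 2 * ∑ k, ∑ x, F x k := by
  rw [← (Block.equivProd n).symm.sum_comp, Fintype.sum_prod_type]
  simp only [Fintype.sum_prod_type, Block.equivProd, Equiv.coe_fn_symm_mk, sum_const]
  simp only [card_univ, Fintype.card_bool, nsmul_eq_mul]
  rw [sum_comm, mul_sum]
  simp [mul_sum]

lemma le_card_good : n * 2 ^ n ≤ #(Block.good n) := by
  have h : (univ : Finset ((Fin n → Bool) × Fin n)).card ≤ #(Block.good n) :=
    card_le_card_of_injOn (fun p => ⟨p.1, p.2, false⟩)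
      (fun p _ => by simp [Block.good, Block.Good])
      (fun p _ q _ h => by simpa [Prod.ext_iff] using h)
  refine le_trans (le_of_eq ?_) h
  simp [mul_comm]

/-- The first `i` blocks. -/
noncomputable def prefixView (i : ℕ) (ξ : Fin m → Block n) : Fin m → Option (Block n) :=
  fun l => if (l : ℕ) < i then some (ξ l) else none

lemma prefixView_eq_iff {i : ℕ} {ξ ξ' : Fin m → Block n} :
    prefixView i ξ = prefixView i ξ' ↔ ∀ l : Fin m, (l : ℕ) < i → ξ l = ξ' l := by
  simp only [prefixView, funext_iff]
  refine forall_congr' fun l => ?_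
  by_cases h : (l : ℕ) < i <;> simp [h]

namespace BlockProtocol

variable {Q 𝒯 : Type*} (P : BlockProtocol m n Q 𝒯)

/-- If the transcript is conditioned on the blocks before block `j` only, block `j` is still uniform
on the good blocks, and the index bound `sum_indexDefect_le` applies to it. -/
lemma sum_condFreq_prefixView_mul_defect_le [Fintype Q] [Nonempty Q] (hn : 0 < n) (τ : 𝒯)
    (j : Fin m) :
    ∑ ξ ∈ validInputs m n, condFreq (validInputs m n) (P.event τ) (prefixView j) ξ *
      P.defect τ j ξ ≤ 6 * Real.log (Fintype.card Q) / n * #(P.event τ) := by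
  set p := condFreq (validInputs m n) (P.event τ) (prefixView j) with hp
  have hupd : ∀ ξ b, P.state τ (Function.update ξ j b) j = P.state τ ξ j := fun ξ b =>
    P.state_congr τ fun l hl => Function.update_of_ne (by rintro rfl; omega) _ _
  have hpu : ∀ ξ b, p (Function.update ξ j b) = p ξ := fun ξ b =>
    condFreq_congr _ _ (prefixView_eq_iff.2 fun l hl =>
      Function.update_of_ne (by rintro rfl; omega) _ _)
  have h1 := card_good_mul_sum (n := n) j (fun ξ => p ξ * P.defect τ j ξ)
  simp only [defect, hupd, hpu, Function.update_self, ← mul_sum] at h1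
  set L := Real.log (Fintype.card Q) with hL
  have hLnn : 0 ≤ L := Real.log_natCast_nonneg _
  have h2 : ∀ ξ : Fin m → Block n,
      ∑ b ∈ Block.good n, indexDefect (P.feed j (P.state τ ξ j)) b.k b.x ≤ 6 * (2 ^ n * L) := by
    intro ξ
    refine (sum_le_univ_sum_of_nonneg fun b => indexDefect_nonneg _ _ _).trans ?_
    rw [sum_block (F := fun x k => indexDefect (P.feed j (P.state τ ξ j)) k x)]
    have := sum_indexDefect_le (P.feed j (P.state τ ξ j))
    linarith
  have h3 : (#(Block.good n) : ℝ) * ∑ ξ ∈ validInputs m n, p ξ * P.defect τ j ξ ≤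
      6 * (2 ^ n * L) * #(P.event τ) := by
    refine h1.trans_le ?_
    rw [← sum_condFreq (P.event_subset τ) (prefixView j), mul_sum]
    refine sum_le_sum fun ξ _ => ?_
    rw [mul_comm]
    exact mul_le_mul_of_nonneg_right (h2 ξ) (condFreq_nonneg _ _ _ _)
  have h4 : (n * 2 ^ n : ℝ) ≤ #(Block.good n) := by exact_mod_cast le_card_good
  have hn' : (0 : ℝ) < n := by exact_mod_cast hn
  have hS : 0 ≤ ∑ ξ ∈ validInputs m n, p ξ * P.defect τ j ξ :=
    sum_nonneg fun ξ _ => mul_nonneg (condFreq_nonneg _ _ _ _) (indexDefect_nonneg _ _ _)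
  have h5 := (mul_le_mul_of_nonneg_right h4 hS).trans h3
  rw [div_mul_eq_mul_div, le_div_iff₀ hn']
  have : (0 : ℝ) < 2 ^ n := by positivity
  refine le_of_mul_le_mul_left ?_ this
  linarith

/-- The law of block `j` given the transcript and the earlier blocks differs from the law in
`sum_condFreq_prefixView_mul_defect_le` by an increment of the chain `prefixView`. -/
lemma sum_event_defect_le [Fintype Q] [Nonempty Q] (hn : 0 < n) (τ : 𝒯) (j : Fin m) :
    ∑ ξ ∈ P.event τ, P.defect τ j ξ ≤
      2 * ∑ ξ ∈ validInputs m n,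
        (√(condFreq (validInputs m n) (P.event τ) (prefixView (j + 1)) ξ) -
        √(condFreq (validInputs m n) (P.event τ) (prefixView j) ξ)) ^ 2 +
      12 * Real.log (Fintype.card Q) / n * #(P.event τ) := by
  have hD : (P.defect τ j).FactorsThrough (prefixView (j + 1)) := by
    intro ξ ξ' h
    rw [prefixView_eq_iff] at h
    have h1 := P.state_congr τ (i := j) fun l hl => h l (by omega)
    simp only [defect, h1, h j (by omega)]
  rw [← sum_condFreq_mul (P.event_subset τ) _ _ hD]
  have h1 := P.sum_condFreq_prefixView_mul_defect_le hn τ j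
  have h2 : ∀ ξ ∈ validInputs m n,
      condFreq (validInputs m n) (P.event τ) (prefixView (j + 1)) ξ * P.defect τ j ξ ≤
      2 * (√(condFreq (validInputs m n) (P.event τ) (prefixView (j + 1)) ξ) -
        √(condFreq (validInputs m n) (P.event τ) (prefixView j) ξ)) ^ 2 +
      2 * (condFreq (validInputs m n) (P.event τ) (prefixView j) ξ * P.defect τ j ξ) := by
    intro ξ _
    have a := Real.sq_sqrt (condFreq_nonneg (validInputs m n) (P.event τ) (prefixView (j + 1)) ξ)
    have b := Real.sq_sqrt (condFreq_nonneg (validInputs m n) (P.event τ) (prefixView j) ξ)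
    have d0 : 0 ≤ P.defect τ j ξ := indexDefect_nonneg _ _ _
    have d1 : P.defect τ j ξ ≤ 1 := indexDefect_le_one _ _ _
    generalize P.defect τ j ξ = D at *
    rw [← a, ← b, Real.sqrt_sq (Real.sqrt_nonneg _), Real.sqrt_sq (Real.sqrt_nonneg _)]
    generalize √(condFreq (validInputs m n) (P.event τ) (prefixView (j + 1)) ξ) = u
    generalize √(condFreq (validInputs m n) (P.event τ) (prefixView j) ξ) = v
    -- the square root of the frequency moves by `u - v`, and `D ≤ 1`
    have h3 : u ^ 2 ≤ 2 * (u - v) ^ 2 + 2 * v ^ 2 := by nlinarith [sq_nonneg (u - 2 * v)]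
    have h4 := mul_le_mul_of_nonneg_right h3 d0
    have h5 := mul_le_mul_of_nonneg_left d1 (sq_nonneg (u - v))
    nlinarith
  refine (sum_le_sum h2).trans ?_
  rw [sum_add_distrib, ← mul_sum, ← mul_sum]
  have : 12 * Real.log (Fintype.card Q) / n * #(P.event τ) =
    2 * (6 * Real.log (Fintype.card Q) / n * #(P.event τ)) := by ring
  rw [this]
  linarith

lemma defect_factorsThrough_midView (τ : 𝒯) (j : Fin m) :
    (P.defect τ j).FactorsThrough (P.midView τ j) := by
  intro ξ ξ' h
  rw [midView_eq_iff] at h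
  obtain ⟨h1, h2, h3⟩ := h
  rw [defect, defect, h1, (h3 j).1]
  refine indexDefect_congr rfl (fun i hi => (h3 j).2.1 i (Or.inl ?_)) ?_
  · rwa [(h3 j).1]
  · rw [mid, mid, h1] at h2; exact h2

/-- Without the transcript, the fibre of the view in the middle of block `j` is a product of a part
that does not depend on block `j` and the strings counted by `indexCount`. -/
lemma card_midView (τ : 𝒯) (j : Fin m) (ξ : Fin m → Block n) (hz : (ξ j).z = false) :
    ∃ C : ℝ, 0 ≤ C ∧ ∀ y, (#(Block.good n) : ℝ) *
      #{ξ' ∈ inputClass j y false | P.midView τ j ξ' = P.midView τ j ξ} =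
        C * indexCount (P.feed j (P.state τ ξ j)) (ξ j).k (ξ j).x y := by
  set R : (Fin m → Block n) → Prop := fun ξ' => P.state τ ξ' j = P.state τ ξ j ∧
    ∀ i, i ≠ j → (ξ' i).k = (ξ i).k ∧
      (∀ a, (ξ' i).k < a ∨ j < i → (ξ' i).x a = (ξ i).x a) ∧ (ξ' i).z = (ξ i).z with hR
  set q : Bool → Block n → Prop := fun y b => b.k = (ξ j).k ∧ b.z = false ∧
    (∀ a, (ξ j).k < a → b.x a = (ξ j).x a) ∧ b.x (ξ j).k = y ∧
    P.feed j (P.state τ ξ j) b.x = P.feed j (P.state τ ξ j) (ξ j).x with hq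
  refine ⟨#{ξ' ∈ validInputs m n | R ξ'}, by positivity, fun y => ?_⟩
  have h1 : ({ξ' ∈ inputClass j y false | P.midView τ j ξ' = P.midView τ j ξ} : Finset _) =
      {ξ' ∈ validInputs m n | R ξ' ∧ q y (ξ' j)} := by
    ext ξ'
    simp only [mem_filter]
    constructor
    · rintro ⟨h1, h2⟩
      refine ⟨inputClass_subset (by simp) h1, ?_⟩
      rw [mem_inputClass] at h1
      rw [midView_eq_iff] at h2
      obtain ⟨h2, h3, h4⟩ := h2
      refine ⟨⟨h2, fun i _ => h4 i⟩, (h4 j).1, h1.2.2, fun a ha => (h4 j).2.1 a (Or.inl ?_), ?_, ?_⟩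
      · rwa [(h4 j).1]
      · rw [← (h4 j).1]; exact h1.2.1
      · rw [mid, mid, h2] at h3; exact h3
    · rintro ⟨h1, ⟨h2, h3⟩, h4, h5, h6, h7, h8⟩
      rw [mem_validInputs] at h1
      refine ⟨mem_inputClass.2 ⟨fun i _ => h1 i, by rw [h4, h7], h5⟩, ?_⟩
      rw [midView_eq_iff]
      refine ⟨h2, by rw [mid, mid, h2, h8], fun i => ?_⟩
      by_cases e : i = j
      · subst e
        refine ⟨h4, fun a ha => h6 a ?_, h5.trans hz.symm⟩
        rw [← h4]; simpa using ha
      · exact h3 i e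
  have hRu : ∀ ξ' b, R (Function.update ξ' j b) ↔ R ξ' := by
    intro ξ' b
    have : P.state τ (Function.update ξ' j b) j = P.state τ ξ' j :=
      P.state_congr τ fun l hl => Function.update_of_ne (by rintro rfl; omega) _ _
    simp only [hR, this]
    refine and_congr_right fun _ => forall_congr' fun i => forall_congr' fun hi => ?_
    rw [Function.update_of_ne hi]
  have h2 := card_filter_mul_card_good j R (q y) hRu
  rw [h1]
  refine Eq.trans (by congr!) (h2.trans (congrArg₂ _ (by congr!) (congrArg _ ?_)))
  unfold indexCount
  refine card_nbij' (fun b => b.x) (fun x => ⟨x, (ξ j).k, false⟩) ?_ ?_ ?_ ?_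
  · intro b hb
    simp only [hq, coe_filter, mem_univ, true_and, Set.mem_ofPred_eq] at hb ⊢
    exact hb.2.2.2
  · intro x hx
    simp only [hq, coe_filter, mem_univ, true_and, Set.mem_ofPred_eq, Block.good,
      Block.Good] at hx ⊢
    simpa using hx
  · intro b hb
    simp only [hq, coe_filter, Set.mem_ofPred_eq] at hb
    exact Block.ext rfl hb.2.1.symm hb.2.2.1.symm
  · intro x _; rfl

variable [Fintype 𝒯] [Fintype Q]

/-- The letter at the position of block `j` changes the law of the cell only a little, on average
over the blocks: once by the information in the transcript, which is at most `log |𝒯|` for all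
blocks together, and once by the message in the middle of the block, which is about a uniform
position out of `n`. -/
lemma sum_string_le [Nonempty 𝒯] [Nonempty Q] (hn : 0 < n) :
    ∑ j, ∑ c, (√(#{ξ ∈ inputClass j false false | P.cell j ξ = c}) -
      √(#{ξ ∈ inputClass j true false | P.cell j ξ = c})) ^ 2 ≤
    #(validInputs m n) * (9 * Real.log (Fintype.card 𝒯) +
      36 * m * Real.log (Fintype.card Q) / n) := by
  set s := validInputs m n with hs
  have hsub : ∀ (j : Fin m) y, inputClass (n := n) j y false ⊆ s :=
    fun j y => inputClass_subset (by simp)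
  have key : ∀ j : Fin m, ∑ c, (√(#{ξ ∈ inputClass j false false | P.cell j ξ = c}) -
      √(#{ξ ∈ inputClass j true false | P.cell j ξ = c})) ^ 2 ≤
      ∑ τ, 3 * (∑ ξ ∈ s, (√(condFreq s (P.event τ) (P.bitView τ j) ξ) -
        √(condFreq s (P.event τ) (P.midView τ j) ξ)) ^ 2 + ∑ ξ ∈ P.event τ, P.defect τ j ξ) := by
    intro j
    refine (sum_sq_sqrt_card_coarsen _ _ (P.cell j)
      (fun ξ => (P.transcript ξ, P.midView (P.transcript ξ) j ξ)) ?_).trans ?_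
    · intro ξ ξ' h
      rw [Prod.mk.injEq] at h
      obtain ⟨hT, h⟩ := h
      rw [← hT, midView_eq_iff] at h
      simp only [cell, Prod.mk.injEq, view_eq_iff, ← hT, true_and]
      exact ⟨h.2.1, fun i => ⟨(h.2.2 i).1, (h.2.2 i).2.1, fun _ => (h.2.2 i).2.2⟩⟩
    · rw [Fintype.sum_prod_type]
      refine sum_le_sum fun τ _ => ?_
      simp only [fun y d => P.filter_event (hsub j y) (fun τ => P.midView τ j) τ d]
      refine (sum_sq_sqrt_card_class_le (P.event_subset τ) (P.midView τ j) (P.bitView τ j)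
        (fun y => inputClass j y false) (hsub j) ?_ ?_ (P.defect τ j)
        (P.defect_factorsThrough_midView τ j) ?_).trans ?_
      · rw [disjoint_left]
        intro ξ h0 h1
        rw [mem_inputClass] at h0 h1
        simp [h0.2.1] at h1
      · intro y ξ hξ ξ' hξ'
        rw [mem_inputClass] at hξ
        rw [mem_validInputs] at hξ'
        simp only [bitView, Prod.mk.injEq, mem_inputClass]
        constructor
        · rintro ⟨h1, h2⟩
          refine ⟨⟨fun i _ => hξ' i, h1.trans hξ.2.1, ?_⟩, h2⟩
          rw [midView_eq_iff] at h2
          rw [(h2.2.2 j).2.2]; exact hξ.2.2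
        · rintro ⟨h1, h2⟩
          exact ⟨h1.2.1.trans hξ.2.1.symm, h2⟩
      · intro y ξ hξ
        rw [mem_inputClass] at hξ
        obtain ⟨C, hC, h⟩ := P.card_midView τ j ξ hξ.2.2
        have hg : (0 : ℝ) < #(Block.good n) := by
          have := le_card_good (n := n)
          have h2 : 0 < n * 2 ^ n := by positivity
          exact_mod_cast h2.trans_le this
        have h' : ∀ y, (#{ξ' ∈ inputClass j y false | P.midView τ j ξ' = P.midView τ j ξ} : ℝ) =
            C / #(Block.good n) * indexCount (P.feed j (P.state τ ξ j)) (ξ j).k (ξ j).x y := by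
          intro y
          rw [div_mul_eq_mul_div, ← h y]; field_simp
        have hC' : 0 ≤ C / #(Block.good n) := by positivity
        rw [h', h', Real.sqrt_mul hC', Real.sqrt_mul hC', ← mul_sub, mul_pow, Real.sq_sqrt hC',
          ← indexDefect_mul, defect]
        apply le_of_eq; ring
      · apply mul_le_mul_of_nonneg_left _ (by norm_num)
        rw [← sum_condFreq_mul (P.event_subset τ) _ _ (P.defect_factorsThrough_midView τ j),
          ← sum_add_distrib]
        exact sum_le_sum_of_subset_of_nonneg (union_subset (hsub _ _) (hsub _ _))
          fun _ _ _ => add_nonneg (sq_nonneg _)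
            (mul_nonneg (condFreq_nonneg _ _ _ _) (indexDefect_nonneg _ _ _))
  refine (sum_le_sum fun j _ => key j).trans ?_
  rw [sum_comm]
  have h1 : ∀ τ, ∑ j, 3 * (∑ ξ ∈ s, (√(condFreq s (P.event τ) (P.bitView τ j) ξ) -
        √(condFreq s (P.event τ) (P.midView τ j) ξ)) ^ 2 + ∑ ξ ∈ P.event τ, P.defect τ j ξ) ≤
      9 * (#s * Real.negMulLog (#(P.event τ) / #s)) +
        36 * m * Real.log (Fintype.card Q) / n * #(P.event τ) := by
    intro τ
    have a : ∑ j, ∑ ξ ∈ s, (√(condFreq s (P.event τ) (P.bitView τ j) ξ) -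
        √(condFreq s (P.event τ) (P.midView τ j) ξ)) ^ 2 ≤
        #s * Real.negMulLog (#(P.event τ) / #s) := by
      refine sum_chain_rev_le (P.event_subset τ) (P.stringView τ) m (P.midView τ) (P.bitView τ)
        ?_ ?_ ?_
      · intro j ξ ξ' h
        rw [midView_eq_iff] at h
        obtain ⟨h1, h2, h3⟩ := h
        simp only [stringView, Prod.mk.injEq, view_eq_iff, true_imp_iff]
        refine ⟨?_, fun i => ⟨(h3 i).1, fun a ha => (h3 i).2.1 a ?_, (h3 i).2.2⟩⟩
        · rw [state_succ, state_succ, h2]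
          exact P.query_congr _ _ (h3 j).1 (h3 j).2.2 fun i hi => (h3 j).2.1 i (Or.inl hi)
        · exact ha.imp_right fun h => Fin.lt_def.2 (Nat.lt_of_succ_le h)
      · intro j ξ ξ' h
        exact (Prod.mk.inj h).2
      · intro j ξ ξ' h
        simp only [stringView, Prod.mk.injEq, view_eq_iff, true_imp_iff] at h
        obtain ⟨h1, h2⟩ := h
        have hx : (ξ j).x = (ξ' j).x := funext fun a => (h2 j).2.1 a (Or.inr le_rfl)
        rw [bitView, bitView, Prod.mk.injEq, midView_eq_iff]
        refine ⟨by rw [hx, (h2 j).1], h1, by rw [mid, mid, h1, hx], fun i => ⟨(h2 i).1,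
          fun a ha => (h2 i).2.1 a (ha.imp_right fun h => le_of_lt (Fin.lt_def.1 h)), (h2 i).2.2⟩⟩
    have b : ∑ j, ∑ ξ ∈ P.event τ, P.defect τ j ξ ≤ 2 * (#s * Real.negMulLog (#(P.event τ) / #s)) +
        m * (12 * Real.log (Fintype.card Q) / n * #(P.event τ)) := by
      refine (sum_le_sum fun j _ => P.sum_event_defect_le hn τ j).trans ?_
      rw [sum_add_distrib, ← mul_sum, sum_const, card_univ, Fintype.card_fin, nsmul_eq_mul]
      refine add_le_add_left (mul_le_mul_of_nonneg_left ?_ (by norm_num)) _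
      refine sum_chain_le (P.event_subset τ) prefixView m fun i _ ξ ξ' h => ?_
      rw [prefixView_eq_iff] at h ⊢
      exact fun l hl => h l (by omega)
    rw [← mul_sum, sum_add_distrib]
    have e : 36 * m * Real.log (Fintype.card Q) / n * #(P.event τ) =
      3 * (m * (12 * Real.log (Fintype.card Q) / n * #(P.event τ))) := by ring
    rw [e]; linarith
  refine (sum_le_sum fun τ _ => h1 τ).trans ?_
  simp only [sum_add_distrib, ← mul_sum]
  have h2 : ∑ τ, (#(P.event τ) : ℝ) = #s := by
    rw [← Nat.cast_sum]
    congr 1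
    exact (card_eq_sum_card_fiberwise (f := P.transcript) (t := univ)
      fun _ _ => mem_coe.2 (mem_univ _)).symm
  have h3 := P.sum_event_negMulLog
  rw [h2]
  simp only [← mul_sum] at h3
  rw [← hs] at h3
  linarith

variable {P}

/-- A set of transcripts separates two classes only as far as their squared Hellinger distance
allows. The constants `6` and `1 / 6` come from `u² - v² ≤ 6 (u - v)² + (u² + v²) / 12`. -/
lemma card_acc_sub_le (acc : 𝒯 → Prop) (j : Fin m) :
    (#{ξ ∈ inputClass (n := n) j false false | acc (P.transcript ξ)} : ℝ) -
      #{ξ ∈ inputClass (n := n) j true true | acc (P.transcript ξ)} ≤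
    6 * ∑ c, (√(#{ξ ∈ inputClass j false false | P.cell j ξ = c}) -
      √(#{ξ ∈ inputClass j true true | P.cell j ξ = c})) ^ 2 +
      #(inputClass (n := n) j false false) / 6 := by
  have h1 : ∀ A : Finset (Fin m → Block n), (#{ξ ∈ A | acc (P.transcript ξ)} : ℝ) =
      ∑ c, if acc c.1 then (#{ξ ∈ A | P.cell j ξ = c} : ℝ) else 0 := by
    intro A
    rw [← sum_filter, ← Nat.cast_sum, card_eq_sum_card_fiberwise (f := P.cell j)
      (t := ({c | acc c.1} : Finset _))]
    · congr 1
      refine sum_congr rfl fun c hc => ?_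
      congr 1
      ext ξ
      simp only [mem_filter, mem_univ, true_and] at hc ⊢
      constructor
      · rintro ⟨⟨a, _⟩, b⟩; exact ⟨a, b⟩
      · rintro ⟨a, b⟩
        refine ⟨⟨a, ?_⟩, b⟩
        rw [← b] at hc; exact hc
    · intro ξ hξ
      simpa [cell] using (mem_filter.1 hξ).2
  have h2 : ∀ A : Finset (Fin m → Block n), ∑ c, (#{ξ ∈ A | P.cell j ξ = c} : ℝ) = #A :=
    fun A => by rw [← Nat.cast_sum, sum_card_cell]
  rw [h1, h1, ← sum_sub_distrib, mul_sum]
  have h3 : (#(inputClass (n := n) j false false) : ℝ) / 6 =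
      ∑ c, ((#{ξ ∈ inputClass j false false | P.cell j ξ = c} : ℝ) +
        #{ξ ∈ inputClass j true true | P.cell j ξ = c}) / 12 := by
    rw [← sum_div, sum_add_distrib, h2, h2, card_inputClass j true true false false]
    ring
  rw [h3, ← sum_add_distrib]
  refine sum_le_sum fun c _ => ?_
  have h4 := Real.sq_sqrt (Nat.cast_nonneg (α := ℝ)
    #{ξ ∈ inputClass j false false | P.cell j ξ = c})
  have h5 := Real.sq_sqrt (Nat.cast_nonneg (α := ℝ)
    #{ξ ∈ inputClass j true true | P.cell j ξ = c})
  generalize √(#{ξ ∈ inputClass j false false | P.cell j ξ = c} : ℝ) = u at *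
  generalize √(#{ξ ∈ inputClass j true true | P.cell j ξ = c} : ℝ) = v at *
  rw [← h4, ← h5]
  split_ifs
  · nlinarith [sq_nonneg (12 * (u - v) - (u + v)), sq_nonneg (u - v)]
  · rw [sub_self]; positivity

/-- A protocol that accepts inputs of the classes (letter, check bit) `= (0, 0)` noticeably more
often than those of the classes `(1, 1)`, on average over the blocks, needs `log |𝒯|` of order `m`
or `log |Q|` of order `n`. -/
theorem blocks_le [Nonempty 𝒯] [Nonempty Q] (hP : P.IsExact) (hn : 0 < n)
    (acc : 𝒯 → Prop)
    (h : ∑ j : Fin m, (#(inputClass (n := n) j false false) : ℝ) ≤ 3 * ∑ j : Fin m,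
      ((#{ξ ∈ inputClass (n := n) j false false | acc (P.transcript ξ)} : ℝ) -
        #{ξ ∈ inputClass (n := n) j true true | acc (P.transcript ξ)})) :
    (m : ℝ) ≤ 2592 * Real.log (Fintype.card 𝒯) + 7776 * m * Real.log (Fintype.card Q) / n := by
  have h1 := sum_le_sum fun (j : Fin m) (_ : j ∈ univ) => card_acc_sub_le (P := P) acc j
  simp only [cut_and_paste hP] at h1
  rw [sum_add_distrib, ← mul_sum, ← sum_div] at h1
  have h2 : ∀ j : Fin m, ∑ c, (√(#{ξ ∈ inputClass j false true | P.cell j ξ = c}) -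
      √(#{ξ ∈ inputClass j true false | P.cell j ξ = c})) ^ 2 ≤
      2 * ∑ c, (√(#{ξ ∈ inputClass j false false | P.cell j ξ = c}) -
        √(#{ξ ∈ inputClass j false true | P.cell j ξ = c})) ^ 2 +
      2 * ∑ c, (√(#{ξ ∈ inputClass j false false | P.cell j ξ = c}) -
        √(#{ξ ∈ inputClass j true false | P.cell j ξ = c})) ^ 2 := by
    intro j
    rw [mul_sum, mul_sum, ← sum_add_distrib]
    refine sum_le_sum fun c _ => ?_
    generalize √(#{ξ ∈ inputClass j false false | P.cell j ξ = c} : ℝ) = u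
    generalize √(#{ξ ∈ inputClass j false true | P.cell j ξ = c} : ℝ) = v
    generalize √(#{ξ ∈ inputClass j true false | P.cell j ξ = c} : ℝ) = w
    nlinarith [sq_nonneg (2 * u - v - w)]
  have h3 := sum_le_sum fun (j : Fin m) (_ : j ∈ univ) => h2 j
  rw [sum_add_distrib, ← mul_sum, ← mul_sum] at h3
  have h4 := P.sum_check_le
  have h5 := P.sum_string_le hn
  have h6 : (m : ℝ) * #(validInputs m n) ≤
      3 * ∑ j : Fin m, (#(inputClass (n := n) j false false) : ℝ) := by
    have : ∑ j : Fin m, (#(validInputs m n) : ℝ) ≤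
        ∑ j : Fin m, 3 * (#(inputClass (n := n) j false false) : ℝ) :=
      sum_le_sum fun j _ => by exact_mod_cast card_validInputs_le j
    rw [← mul_sum] at this
    simpa using this
  have hs : (0 : ℝ) < #(validInputs m n) := by
    have : (fun _ => ⟨fun _ => false, ⟨0, hn⟩, false⟩ : Fin m → Block n) ∈ validInputs m n :=
      mem_validInputs.2 fun i => by simp [Block.Good]
    exact_mod_cast card_pos.2 ⟨_, this⟩
  have e : (#(validInputs m n) : ℝ) * (9 * Real.log (Fintype.card 𝒯) +
      36 * m * Real.log (Fintype.card Q) / n) = 9 * (#(validInputs m n) *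
        Real.log (Fintype.card 𝒯)) + #(validInputs m n) *
          (36 * m * Real.log (Fintype.card Q) / n) := by ring
  rw [e] at h5
  refine le_of_mul_le_mul_left ?_ hs
  have e2 : (#(validInputs m n) : ℝ) * (2592 * Real.log (Fintype.card 𝒯) +
      7776 * m * Real.log (Fintype.card Q) / n) =
      2592 * (#(validInputs m n) * Real.log (Fintype.card 𝒯)) +
        216 * (#(validInputs m n) * (36 * m * Real.log (Fintype.card Q) / n)) := by ring
  rw [e2]
  linarith

end BlockProtocol
end Strings

/-! ### Words and their contents -/

section Contents

lemma contents_succ_ins {α : Type} [DecidableEq α] {N : ℕ} {w : Fin N → Op α} {i : ℕ} (h : i < N)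
    {a : α} (ha : w ⟨i, h⟩ = Op.ins a) : contents w (i + 1) = a ::ₘ contents w i := by
  rw [contents, dif_pos h, ha]

lemma contents_succ_ext {α : Type} [DecidableEq α] {N : ℕ} {w : Fin N → Op α} {i : ℕ} (h : i < N)
    {a : α} (ha : w ⟨i, h⟩ = Op.ext a) : contents w (i + 1) = (contents w i).erase a := by
  rw [contents, dif_pos h, ha]

/-- An inserted item stays in the multiset as long as no copy of it is extracted. -/
lemma mem_contents_of_ins {α : Type} [DecidableEq α] {N : ℕ} {w : Fin N → Op α} {a : α} {i : ℕ}
    (hi : i < N) (ha : w ⟨i, hi⟩ = Op.ins a) {t : ℕ} (hit : i + 1 ≤ t)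
    (hext : ∀ l (hl : l < N), i < l → l < t → w ⟨l, hl⟩ ≠ Op.ext a) : a ∈ contents w t := by
  induction t, hit using Nat.le_induction with
  | base => rw [contents_succ_ins hi ha]; exact Multiset.mem_cons_self _ _
  | succ t hit ih =>
    have ih' := ih fun l hl h1 h2 => hext l hl h1 (by omega)
    by_cases ht : t < N
    · cases hw : w ⟨t, ht⟩ with
      | ins b => rw [contents_succ_ins ht hw]; exact Multiset.mem_cons_of_mem ih'
      | ext b =>
        rw [contents_succ_ext ht hw, Multiset.mem_erase_of_ne]
        · exact ih'
        · rintro rfl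
          exact hext t ht hit (by omega) hw
    · rw [contents, dif_neg ht]; exact ih'

/-- As long as only present stamped items are extracted, forgetting the timestamps commutes with the
operations. -/
lemma contents_fst {U N : ℕ} {w : Fin N → StampedOp U}
    (hw : ∀ i a, (w i).toOp = Op.ext a → a ∈ contents (fun i => (w i).toOp) i) (t : ℕ) :
    contents (fun i => (w i).1) t = (contents (fun i => (w i).toOp) t).map Prod.fst := by
  induction t with
  | zero => rfl
  | succ t ih =>
    by_cases ht : t < N
    · obtain ⟨o, q, ho⟩ : ∃ o q, w ⟨t, ht⟩ = (o, q) := ⟨_, _, rfl⟩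
      cases o with
      | ins a =>
        rw [contents_succ_ins ht (a := a) (by simp [ho]),
          contents_succ_ins ht (a := (a, q)) (by simp [ho, StampedOp.toOp]), ih]
        simp
      | ext a =>
        have hx : (w ⟨t, ht⟩).toOp = Op.ext (a, q) := by simp [ho, StampedOp.toOp]
        rw [contents_succ_ext ht (a := a) (by simp [ho]), contents_succ_ext ht (a := (a, q)) hx, ih,
          Multiset.map_erase_of_mem _ _ (hw _ _ hx)]
    · rw [contents, contents, dif_neg ht, dif_neg ht, ih]

/-- It suffices to look at the stamped items: the extracted item is present and has a largest value.
-/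
lemma mem_PQTS_of_stamped {U N : ℕ} {w : Fin N → StampedOp U}
    (h0 : contents (fun i => (w i).toOp) N = 0)
    (hw : ∀ i a, (w i).toOp = Op.ext a → a ∈ contents (fun i => (w i).toOp) i ∧
      ∀ b ∈ contents (fun i => (w i).toOp) i, b.1 ≤ a.1)
    (ht : ∀ i a, (w i).1 = Op.ins a → (w i).2 = (i : ℕ) + 1) : w ∈ PQTS U N := by
  have hf := contents_fst fun i a h => (hw i a h).1
  have key : ∀ i a, (w i).1 = Op.ext a → a ∈ contents (fun i => (w i).1) i ∧
      ∀ b ∈ contents (fun i => (w i).1) i, b ≤ a := by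
    intro i a ha
    have hx : (w i).toOp = Op.ext (a, (w i).2) := by
      obtain ⟨o, q, ho⟩ : ∃ o q, w i = (o, q) := ⟨_, _, rfl⟩
      rw [ho] at ha ⊢
      simp only at ha
      subst ha; rfl
    obtain ⟨h1, h2⟩ := hw i _ hx
    rw [hf]
    refine ⟨Multiset.mem_map.2 ⟨_, h1, rfl⟩, fun b hb => ?_⟩
    obtain ⟨c, hc, rfl⟩ := Multiset.mem_map.1 hb
    exact h2 c hc
  refine ⟨⟨h0, fun i a h => (hw i a h).1⟩, ⟨⟨by rw [hf, h0]; rfl, fun i a h => (key i a h).1⟩,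
    fun i a h => ⟨(key i a h).1, (key i a h).2⟩⟩, ht⟩

end Contents

/-! ### Schedules of slots of two letters -/

/-- The action of two consecutive letters, at the positions `2σ` and `2σ + 1` of the word: insert
two copies of the item `a`, extract the two copies of `a`, or insert the value `c` and extract it at
once. The last action is legal if and only if no larger value is present. -/
inductive Slot (ι β : Type) : Type where
  /-- insert two copies of the item -/
  | put (a : ι) : Slot ι β
  /-- extract the two copies of the item -/
  | take (a : ι) : Slot ι β
  /-- insert a value and extract it at once -/
  | check (c : β) : Slot ι β

/-- The letter of a slot at the position `t`, counted from `0`, where `val a` is the value of the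
item `a` and `birth a` the index of the slot in which it is inserted. The copies of `a` have the
timestamps `2 * birth a + 1` and `2 * birth a + 2`, and are extracted in this order. -/
def Slot.letter {ι : Type} {U : ℕ} (val : ι → Fin (U + 1)) (birth : ι → ℕ) (t : ℕ) :
    Slot ι (Fin (U + 1)) → StampedOp U
  | put a => (Op.ins (val a), t + 1)
  | take a => (Op.ext (val a), 2 * birth a + t % 2 + 1)
  | check c => if t % 2 = 0 then (Op.ins c, t + 1) else (Op.ext c, t)

section Schedule
open Finset

variable {ι : Type} [Fintype ι] [DecidableEq ι] {U : ℕ}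

/-- The items present just before slot `σ`, which are inserted before `σ` and extracted at `σ` or
later. -/
def alive (birth death : ι → ℕ) (σ : ℕ) : Finset ι := {a | birth a < σ ∧ σ ≤ death a}

/-- The two stamped copies of an item. -/
def stampedPair (val : ι → Fin (U + 1)) (birth : ι → ℕ) (a : ι) : Multiset (Fin (U + 1) × ℕ) :=
  {(val a, 2 * birth a + 1), (val a, 2 * birth a + 2)}

/-- A schedule of slots is a word of `PQTS` if each item is inserted in its slot `birth` and
extracted in its later slot `death`, no larger item is alive at its extraction, and no value larger
than `c` is alive at a `check c`. By induction the contents before slot `σ` are the pairs of copies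
of the alive items. -/
theorem mem_PQTS_of_schedule {N L : ℕ} (hN : N = 2 * L) (slot : ℕ → Slot ι (Fin (U + 1)))
    (val : ι → Fin (U + 1)) (birth death : ι → ℕ)
    (hput : ∀ σ < L, ∀ a, slot σ = Slot.put a ↔ birth a = σ)
    (htake : ∀ σ < L, ∀ a, slot σ = Slot.take a ↔ death a = σ)
    (hbd : ∀ a, birth a < death a) (hd : ∀ a, death a < L)
    (hmax : ∀ a b, birth b < death a → death a ≤ death b → val b ≤ val a)
    (hcheck : ∀ σ < L, ∀ c, slot σ = Slot.check c → ∀ b, birth b < σ → σ ≤ death b → val b ≤ c) :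
    (fun t : Fin N => (slot (t / 2)).letter val birth t) ∈ PQTS U N := by
  subst hN
  set w : Fin (2 * L) → StampedOp U := fun t => (slot (t / 2)).letter val birth t with hw
  set v : Fin (2 * L) → Op (Fin (U + 1) × ℕ) := fun i => (w i).toOp with hv
  set S : ℕ → Multiset (Fin (U + 1) × ℕ) :=
    fun σ => ∑ a ∈ alive birth death σ, stampedPair val birth a with hS
  have hmem : ∀ σ x, x ∈ S σ → ∃ a, birth a < σ ∧ σ ≤ death a ∧ x.1 = val a := by
    intro σ x hx
    rw [hS, Multiset.mem_sum] at hx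
    obtain ⟨a, ha, hx⟩ := hx
    simp only [alive, mem_filter, mem_univ, true_and] at ha
    refine ⟨a, ha.1, ha.2, ?_⟩
    simp only [stampedPair, Multiset.insert_eq_cons, Multiset.mem_cons,
      Multiset.mem_singleton] at hx
    rcases hx with rfl | rfl <;> rfl
  have he : ∀ σ (h : σ < L) , v ⟨2 * σ, by omega⟩ =
      StampedOp.toOp ((slot σ).letter val birth (2 * σ)) := by
    intro σ h; simp [hv, hw]
  have ho : ∀ σ (h : σ < L) , v ⟨2 * σ + 1, by omega⟩ =
      StampedOp.toOp ((slot σ).letter val birth (2 * σ + 1)) := by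
    intro σ h
    have : (2 * σ + 1) / 2 = σ := by omega
    simp [hv, hw, this]
  have hodd : ∀ σ, (2 * σ + 1) % 2 = 1 := fun σ => by omega
  -- one slot: the contents inside it and after it
  have hstep : ∀ σ (hσ : σ < L), contents v (2 * σ) = S σ → contents v (2 * σ + 2) = S (σ + 1) ∧
      (∀ x, v ⟨2 * σ, by omega⟩ = Op.ext x → x ∈ S σ ∧ ∀ y ∈ S σ, y.1 ≤ x.1) ∧
      (∀ x, v ⟨2 * σ + 1, by omega⟩ = Op.ext x → x ∈ contents v (2 * σ + 1) ∧
        ∀ y ∈ contents v (2 * σ + 1), y.1 ≤ x.1) := by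
    intro σ hσ hc
    have e1 := he σ hσ
    have e2 := ho σ hσ
    cases hs : slot σ with
    | put a =>
      have hb := (hput σ hσ a).1 hs
      simp only [hs, Slot.letter, StampedOp.toOp] at e1 e2
      refine ⟨?_, by rw [e1]; simp, by rw [e2]; simp⟩
      rw [contents_succ_ins (by omega) e2, contents_succ_ins (by omega) e1, hc]
      have hal : alive birth death (σ + 1) = insert a (alive birth death σ) := by
        ext b
        simp only [alive, mem_filter, mem_univ, true_and, mem_insert]
        constructor
        · rintro ⟨h1, h2⟩
          by_cases hb' : birth b = σ
          · left
            have := (hput σ hσ b).2 hb'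
            rw [hs] at this
            exact (Slot.put.inj this).symm
          · right; omega
        · rintro (rfl | ⟨h1, h2⟩)
          · have := hbd b; omega
          · refine ⟨by omega, ?_⟩
            rcases h2.eq_or_lt with h3 | h3
            · have := (htake σ hσ b).2 h3.symm
              rw [hs] at this; cases this
            · exact h3
      have hna : a ∉ alive birth death σ := by
        simp [alive, hb]
      simp only [hS, hal, sum_insert hna, stampedPair, Multiset.insert_eq_cons,
        Multiset.cons_add, Multiset.singleton_add, hb]
      exact Multiset.cons_swap _ _ _
    | take a =>
      have hd' := (htake σ hσ a).1 hs
      simp only [hs, Slot.letter, StampedOp.toOp, hodd, Nat.mul_mod_right, add_zero] at e1 e2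
      have haa : a ∈ alive birth death σ := by
        have := hbd a
        simp only [alive, mem_filter, mem_univ, true_and]; omega
      have hal : alive birth death (σ + 1) = (alive birth death σ).erase a := by
        ext b
        simp only [alive, mem_filter, mem_univ, true_and, mem_erase]
        constructor
        · rintro ⟨h1, h2⟩
          refine ⟨by rintro rfl; omega, ?_, by omega⟩
          by_cases hb' : birth b = σ
          · have := (hput σ hσ b).2 hb'
            rw [hs] at this; cases this
          · omega
        · rintro ⟨h1, h2, h3⟩
          refine ⟨by omega, ?_⟩
          rcases h3.eq_or_lt with h4 | h4
          · have := (htake σ hσ b).2 h4.symm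
            rw [hs] at this
            exact absurd (Slot.take.inj this).symm h1
          · exact h4
      have hsum : S σ = (val a, 2 * birth a + 1) ::ₘ (val a, 2 * birth a + 2) ::ₘ S (σ + 1) := by
        simp only [hS, hal]
        rw [← add_sum_erase _ _ haa]
        simp [stampedPair]
      have hc1 : contents v (2 * σ + 1) = (val a, 2 * birth a + 2) ::ₘ S (σ + 1) := by
        rw [contents_succ_ext (by omega) e1, hc, hsum, Multiset.erase_cons_head]
      have hle : ∀ y ∈ S σ, y.1 ≤ val a := by
        intro y hy
        obtain ⟨b, h1, h2, h3⟩ := hmem σ y hy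
        rw [h3]; exact hmax a b (by omega) (by omega)
      refine ⟨?_, ?_, ?_⟩
      · rw [contents_succ_ext (by omega) e2, hc1, Multiset.erase_cons_head]
      · intro x hx
        rw [e1] at hx
        obtain rfl := Op.ext.inj hx
        exact ⟨by rw [hsum]; exact Multiset.mem_cons_self _ _, hle⟩
      · intro x hx
        rw [e2] at hx
        obtain rfl := Op.ext.inj hx
        rw [hc1]
        refine ⟨Multiset.mem_cons_self _ _, fun y hy => hle y ?_⟩
        rw [hsum]; exact Multiset.mem_cons_of_mem hy
    | check c =>
      have hck := hcheck σ hσ c hs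
      simp only [hs, Slot.letter, StampedOp.toOp, hodd, Nat.mul_mod_right, if_true, one_ne_zero,
        if_false] at e1 e2
      have hal : alive birth death (σ + 1) = alive birth death σ := by
        ext b
        simp only [alive, mem_filter, mem_univ, true_and]
        constructor
        · rintro ⟨h1, h2⟩
          refine ⟨?_, by omega⟩
          by_cases hb' : birth b = σ
          · have := (hput σ hσ b).2 hb'
            rw [hs] at this; cases this
          · omega
        · rintro ⟨h2, h3⟩
          refine ⟨by omega, ?_⟩
          rcases h3.eq_or_lt with h4 | h4
          · have := (htake σ hσ b).2 h4.symm
            rw [hs] at this; cases this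
          · exact h4
      have hc1 : contents v (2 * σ + 1) = (c, 2 * σ + 1) ::ₘ S σ := by
        rw [contents_succ_ins (by omega) e1, hc]
      refine ⟨?_, by rw [e1]; simp, ?_⟩
      · rw [contents_succ_ext (by omega) e2, hc1, Multiset.erase_cons_head]
        simp only [hS, hal]
      · intro x hx
        rw [e2] at hx
        obtain rfl := Op.ext.inj hx
        rw [hc1]
        refine ⟨Multiset.mem_cons_self _ _, fun y hy => ?_⟩
        rcases Multiset.mem_cons.1 hy with rfl | hy
        · exact le_rfl
        · obtain ⟨b, h1, h2, h3⟩ := hmem σ y hy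
          rw [h3]; exact hck b h1 h2
  have hall : ∀ σ, σ ≤ L → contents v (2 * σ) = S σ := by
    intro σ
    induction σ with
    | zero =>
      intro _
      simp [contents, hS, alive]
    | succ σ ih =>
      intro h
      exact (hstep σ (by omega) (ih (by omega))).1
  refine mem_PQTS_of_stamped ?_ ?_ ?_
  · have h1 := hall L le_rfl
    have : alive birth death L = ∅ := by
      rw [alive, filter_eq_empty_iff]
      intro a _ h
      have := hd a; omega
    have h2 : S L = 0 := by simp [hS, this]
    exact h1.trans h2
  · rintro ⟨i, hi⟩ x hx
    obtain ⟨σ, hσ⟩ := Nat.even_or_odd' i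
    have hσL : σ < L := by omega
    have hst := hstep σ hσL (hall σ hσL.le)
    rcases hσ with rfl | rfl
    · have := hst.2.1 x hx
      rwa [← hall σ hσL.le] at this
    · exact hst.2.2 x hx
  · rintro ⟨i, hi⟩ a ha
    simp only [hw] at ha ⊢
    cases hs : slot (i / 2) with
    | put b => simp [Slot.letter]
    | take b => rw [hs] at ha; simp [Slot.letter] at ha
    | check c =>
      rw [hs] at ha
      simp only [Slot.letter] at ha ⊢
      split_ifs at ha ⊢
      simp_all

end Schedule

/-! ### The hard words -/

section HardWords

variable {m n : ℕ}

/-- The item with value `v`, truncated at the largest item `U`. -/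
def clampItem (U v : ℕ) : Fin (U + 1) := ⟨min v U, by omega⟩

lemma clampItem_le_iff {U v v' : ℕ} (h : v ≤ U) (h' : v' ≤ U) :
    clampItem U v ≤ clampItem U v' ↔ v ≤ v' := by
  simp only [clampItem, Fin.mk_le_mk]; omega

lemma clampItem_inj {U v v' : ℕ} (h : v ≤ U) (h' : v' ≤ U) :
    clampItem U v = clampItem U v' ↔ v = v' := by
  simp only [clampItem, Fin.mk.injEq]; omega

/-- The slot in which letter `i` of block `j` is inserted. Block `j` occupies the slots from `2nj`
to `2n(j + 1) - 1`: the first `n` of them insert the string in increasing order, the last `n` go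
through the positions in decreasing order. -/
def itemBirth (a : Fin m × Fin n) : ℕ := 2 * (n * a.1) + a.2

/-- The slot in which letter `i` of block `j` is extracted: in the second half of block `j` if `i`
lies after the position of the block, and otherwise in the tail, the slots from `2nm` to `3nm - 1`,
which go through all letters in decreasing order. -/
def itemDeath (ξ : Fin m → Block n) (a : Fin m × Fin n) : ℕ :=
  if a.2 ≤ (ξ a.1).k then 3 * (m * n) - 1 - (n * a.1 + a.2) else 2 * (n * a.1) + (2 * n - 1 - a.2)

/-- The value of letter `i` of block `j`: one of the two values `2(nj + i)` and `2(nj + i) + 1`. -/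
def itemValue (U : ℕ) (ξ : Fin m → Block n) (a : Fin m × Fin n) : Fin (U + 1) :=
  clampItem U (2 * (n * a.1 + a.2) + ((ξ a.1).x a.2).toNat)

/-- The value inserted and extracted by the checks of block `j`. It lies below the value of the
letter at the position `k` if the letter is `true` and the check bit is set, and otherwise is at
least this value. -/
def checkValue (U : ℕ) (j : Fin m) (b : Block n) : Fin (U + 1) :=
  clampItem U (2 * (n * j + b.k) + (!b.z).toNat)

/-- The slots of a hard word: the blocks, the tail, and idle checks with a value above all items.
The slots in the second half of a block that go through the positions up to `k` check `checkValue`,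
and the tail is idle at the letters that are extracted already. -/
def hardSlot (U : ℕ) (ξ : Fin m → Block n) (σ : ℕ) : Slot (Fin m × Fin n) (Fin (U + 1)) :=
  if h : σ < 2 * n * m then
    if hu : σ % (2 * n) < n then
      Slot.put (⟨σ / (2 * n), Nat.div_lt_of_lt_mul h⟩, ⟨σ % (2 * n), hu⟩)
    else if (ξ ⟨σ / (2 * n), Nat.div_lt_of_lt_mul h⟩).k < 2 * n - 1 - σ % (2 * n) then
      Slot.take (⟨σ / (2 * n), Nat.div_lt_of_lt_mul h⟩, ⟨2 * n - 1 - σ % (2 * n), by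
        have : 0 < 2 * n := Nat.pos_of_ne_zero fun e => by simp [e] at h
        omega⟩)
    else Slot.check (checkValue U ⟨σ / (2 * n), Nat.div_lt_of_lt_mul h⟩
      (ξ ⟨σ / (2 * n), Nat.div_lt_of_lt_mul h⟩))
  else if h : 3 * (m * n) - 1 - σ < n * m ∧ σ < 3 * (m * n) then
    if (3 * (m * n) - 1 - σ) % n ≤ (ξ ⟨_, Nat.div_lt_of_lt_mul h.1⟩).k then
      Slot.take (⟨_, Nat.div_lt_of_lt_mul h.1⟩, ⟨(3 * (m * n) - 1 - σ) % n, Nat.mod_lt _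
        (Nat.pos_of_ne_zero fun e => by simp [e] at h)⟩)
    else Slot.check (clampItem U (2 * (m * n)))
  else Slot.check (clampItem U (2 * (m * n)))

lemma mul_add_le (j : Fin m) : n * j + n ≤ m * n := by
  have := Nat.mul_le_mul_left n (Nat.succ_le_of_lt j.2)
  rw [Nat.mul_succ, mul_comm n m] at this
  exact this

lemma mul_add_le_of_lt {j j' : Fin m} (h : j < j') : n * j + n ≤ n * j' := by
  have := Nat.mul_le_mul_left n (Nat.succ_le_of_lt (Fin.lt_def.1 h))
  rw [Nat.mul_succ] at this
  exact this

lemma hardSlot_birth (U : ℕ) (ξ : Fin m → Block n) (j : Fin m) (i : Fin n) :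
    hardSlot U ξ (2 * (n * j) + i) = Slot.put (j, i) := by
  have hj := mul_add_le (n := n) j
  have hi := i.2
  have h1 : (2 * (n * j) + i : ℕ) < 2 * n * m := by nlinarith
  have h2 : (2 * (n * j) + i : ℕ) / (2 * n) = j := by
    rw [← mul_assoc, Nat.mul_add_div (by omega), Nat.div_eq_of_lt (by omega), add_zero]
  have h3 : (2 * (n * j) + i : ℕ) % (2 * n) = i := by
    rw [← mul_assoc, Nat.mul_add_mod, Nat.mod_eq_of_lt (by omega)]
  rw [hardSlot, dif_pos h1, dif_pos (by rw [h3]; exact hi)]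
  simp only [h2, h3]

lemma hardSlot_query (U : ℕ) (ξ : Fin m → Block n) (j : Fin m) (i : Fin n) :
    hardSlot U ξ (2 * (n * j) + (2 * n - 1 - i)) =
      if (ξ j).k < i then Slot.take (j, i) else Slot.check (checkValue U j (ξ j)) := by
  have hj := mul_add_le (n := n) j
  have hi := i.2
  have h1 : (2 * (n * j) + (2 * n - 1 - i) : ℕ) < 2 * n * m := by
    have : 2 * n - 1 - i < 2 * n := by omega
    nlinarith
  have h2 : (2 * (n * j) + (2 * n - 1 - i) : ℕ) / (2 * n) = j := by
    rw [← mul_assoc, Nat.mul_add_div (by omega), Nat.div_eq_of_lt (by omega), add_zero]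
  have h3 : (2 * (n * j) + (2 * n - 1 - i) : ℕ) % (2 * n) = 2 * n - 1 - i := by
    rw [← mul_assoc, Nat.mul_add_mod, Nat.mod_eq_of_lt (by omega)]
  have h4 : 2 * n - 1 - (2 * n - 1 - i) = (i : ℕ) := by omega
  rw [hardSlot, dif_pos h1, dif_neg (by rw [h3]; omega)]
  simp only [h2, h3, h4, Fin.lt_def, Fin.eta]

lemma hardSlot_tail (U : ℕ) (ξ : Fin m → Block n) (j : Fin m) (i : Fin n) :
    hardSlot U ξ (3 * (m * n) - 1 - (n * j + i)) =
      if i ≤ (ξ j).k then Slot.take (j, i) else Slot.check (clampItem U (2 * (m * n))) := by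
  have hj := mul_add_le (n := n) j
  have hi := i.2
  have hc : 2 * n * m = 2 * (m * n) := by ring
  have hc' : n * m = m * n := mul_comm _ _
  have h0 : 3 * (m * n) - 1 - (3 * (m * n) - 1 - (n * j + i)) = n * j + i := by omega
  have h2 : (n * j + i : ℕ) / n = j := by
    rw [Nat.mul_add_div (by omega), Nat.div_eq_of_lt (by omega), add_zero]
  have h3 : (n * j + i : ℕ) % n = i := by
    rw [Nat.mul_add_mod, Nat.mod_eq_of_lt (by omega)]
  rw [hardSlot, dif_neg (by omega), dif_pos (by omega)]
  simp only [h0, h2, h3, Fin.le_def, Fin.eta]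

lemma hardSlot_of_le (U : ℕ) (ξ : Fin m → Block n) {σ : ℕ} (h : 3 * (m * n) ≤ σ) :
    hardSlot U ξ σ = Slot.check (clampItem U (2 * (m * n))) := by
  have hc : 2 * n * m = 2 * (m * n) := by ring
  rw [hardSlot, dif_neg (by omega), dif_neg (by omega)]

/-- The slots are those of the first halves, the second halves, the tail, and the idle ones at the
end. -/
lemma slot_index_cases (m n σ : ℕ) :
    (∃ (j : Fin m) (i : Fin n), σ = 2 * (n * j) + i) ∨
    (∃ (j : Fin m) (i : Fin n), σ = 2 * (n * j) + (2 * n - 1 - i)) ∨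
    (∃ (j : Fin m) (i : Fin n), σ = 3 * (m * n) - 1 - (n * j + i)) ∨ 3 * (m * n) ≤ σ := by
  have hc : 2 * n * m = 2 * (m * n) := by ring
  have hc' : n * m = m * n := mul_comm _ _
  rcases lt_or_ge σ (2 * (m * n)) with h | h
  · have hn : 0 < n := Nat.pos_of_ne_zero fun e => by simp [e] at h
    have hj : σ / (2 * n) < m := Nat.div_lt_of_lt_mul (by omega)
    have hm := Nat.div_add_mod σ (2 * n)
    have hl := Nat.mod_lt σ (show 0 < 2 * n by omega)
    rw [mul_assoc] at hm
    rcases lt_or_ge (σ % (2 * n)) n with h1 | h1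
    · exact Or.inl ⟨⟨_, hj⟩, ⟨_, h1⟩, hm.symm⟩
    · refine Or.inr (Or.inl ⟨⟨_, hj⟩, ⟨2 * n - 1 - σ % (2 * n), by omega⟩, ?_⟩)
      simp only; omega
  · rcases lt_or_ge σ (3 * (m * n)) with h2 | h2
    · have hn : 0 < n := Nat.pos_of_ne_zero fun e => by simp [e] at h2
      have hm := Nat.div_add_mod (3 * (m * n) - 1 - σ) n
      refine Or.inr (Or.inr (Or.inl ⟨⟨(3 * (m * n) - 1 - σ) / n,
        Nat.div_lt_of_lt_mul (by omega)⟩, ⟨(3 * (m * n) - 1 - σ) % n, Nat.mod_lt _ hn⟩, ?_⟩))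
      simp only; omega
    · exact Or.inr (Or.inr (Or.inr h2))

/-- The hard word of an input of `m` blocks. -/
def hardWord (U N : ℕ) (ξ : Fin m → Block n) : Fin N → StampedOp U :=
  fun t => (hardSlot U ξ (t / 2)).letter (itemValue U ξ) itemBirth t

lemma itemDeath_of_le {ξ : Fin m → Block n} {j : Fin m} {i : Fin n} (h : i ≤ (ξ j).k) :
    itemDeath ξ (j, i) = 3 * (m * n) - 1 - (n * j + i) := if_pos h

lemma itemDeath_of_lt {ξ : Fin m → Block n} {j : Fin m} {i : Fin n} (h : (ξ j).k < i) :
    itemDeath ξ (j, i) = 2 * (n * j) + (2 * n - 1 - i) := if_neg (not_le.2 h)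

lemma toNat_le_one (b : Bool) : b.toNat ≤ 1 := by cases b <;> simp

theorem hardWord_mem {U N : ℕ} (hN : Even N) (hmn : 6 * (m * n) ≤ N) (hU : 2 * (m * n) ≤ U)
    {ξ : Fin m → Block n} (hξ : ∀ j, (ξ j).Good) : hardWord U N ξ ∈ PQTS U N := by
  obtain ⟨L, hL⟩ := hN
  have hval : ∀ (j : Fin m) (i : Fin n), 2 * (n * j + i) + ((ξ j).x i).toNat ≤ U := by
    intro j i
    have := mul_add_le (n := n) j
    have := i.2
    have := toNat_le_one ((ξ j).x i)
    omega
  have hchk : ∀ (j : Fin m), 2 * (n * j + (ξ j).k) + (!(ξ j).z).toNat ≤ U := by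
    intro j
    have := mul_add_le (n := n) j
    have := (ξ j).k.2
    have := toNat_le_one (!(ξ j).z)
    omega
  -- an item alive in the query part of block `j`, at level `i`
  have hquery : ∀ (j j' : Fin m) (i i' : Fin n),
      itemBirth (j', i') < 2 * (n * j) + (2 * n - 1 - i) →
      2 * (n * j) + (2 * n - 1 - i) ≤ itemDeath ξ (j', i') →
      j' < j ∨ (j' = j ∧ (i' ≤ (ξ j).k ∨ i' ≤ i)) := by
    intro j j' i i' h1 h2
    rcases lt_trichotomy j' j with h | h | h
    · exact Or.inl h
    · subst h
      refine Or.inr ⟨rfl, ?_⟩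
      rcases le_or_gt i' (ξ j').k with h3 | h3
      · exact Or.inl h3
      · rw [itemDeath_of_lt h3] at h2
        right
        rw [Fin.le_def]
        have := i.2
        have := i'.2
        omega
    · have h3 := mul_add_le_of_lt (n := n) h
      simp only [itemBirth] at h1
      have := i.2
      omega
  refine mem_PQTS_of_schedule (L := L) (by omega) (hardSlot U ξ) (itemValue U ξ) itemBirth
    (itemDeath ξ) ?_ ?_ ?_ ?_ ?_ ?_
  · rintro σ - ⟨j, i⟩
    constructor
    · intro h
      rcases slot_index_cases m n σ with ⟨j', i', rfl⟩ | ⟨j', i', rfl⟩ | ⟨j', i', rfl⟩ | h'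
      · rw [hardSlot_birth] at h
        obtain ⟨rfl, rfl⟩ := Prod.mk.inj (Slot.put.inj h)
        rfl
      · rw [hardSlot_query] at h
        split_ifs at h
      · rw [hardSlot_tail] at h
        split_ifs at h
      · rw [hardSlot_of_le _ _ h'] at h; cases h
    · rintro rfl
      exact hardSlot_birth U ξ j i
  · rintro σ - ⟨j, i⟩
    constructor
    · intro h
      rcases slot_index_cases m n σ with ⟨j', i', rfl⟩ | ⟨j', i', rfl⟩ | ⟨j', i', rfl⟩ | h'
      · rw [hardSlot_birth] at h; cases h
      · rw [hardSlot_query] at h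
        split_ifs at h with hk
        obtain ⟨rfl, rfl⟩ := Prod.mk.inj (Slot.take.inj h)
        exact itemDeath_of_lt hk
      · rw [hardSlot_tail] at h
        split_ifs at h with hk
        obtain ⟨rfl, rfl⟩ := Prod.mk.inj (Slot.take.inj h)
        exact itemDeath_of_le hk
      · rw [hardSlot_of_le _ _ h'] at h; cases h
    · rintro rfl
      rcases le_or_gt i (ξ j).k with hk | hk
      · rw [itemDeath_of_le hk, hardSlot_tail, if_pos hk]
      · rw [itemDeath_of_lt hk, hardSlot_query, if_pos hk]
  · rintro ⟨j, i⟩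
    have := mul_add_le (n := n) j
    have := i.2
    rcases le_or_gt i (ξ j).k with hk | hk
    · rw [itemDeath_of_le hk]; simp only [itemBirth]; omega
    · rw [itemDeath_of_lt hk]; simp only [itemBirth]; omega
  · rintro ⟨j, i⟩
    have := mul_add_le (n := n) j
    have := i.2
    rcases le_or_gt i (ξ j).k with hk | hk
    · rw [itemDeath_of_le hk]; omega
    · rw [itemDeath_of_lt hk]; omega
  -- an extracted item is the last one alive in the order of blocks and positions
  · rintro ⟨j, i⟩ ⟨j', i'⟩ h1 h2
    rw [itemValue, itemValue, clampItem_le_iff (hval _ _) (hval _ _)]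
    simp only
    have hj := mul_add_le (n := n) j
    have hj' := mul_add_le (n := n) j'
    have hi := i.2
    have hi' := i'.2
    have b1 := toNat_le_one ((ξ j').x i')
    rcases le_or_gt i (ξ j).k with hk | hk
    · rw [itemDeath_of_le hk] at h1 h2
      rcases le_or_gt i' (ξ j').k with hk' | hk'
      · rw [itemDeath_of_le hk'] at h2
        rcases lt_trichotomy j' j with h | h | h
        · have := mul_add_le_of_lt (n := n) h; omega
        · subst h
          rcases lt_trichotomy i' i with h3 | h3 | h3
          · rw [Fin.lt_def] at h3; omega
          · subst h3; exact le_rfl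
          · rw [Fin.lt_def] at h3; omega
        · have := mul_add_le_of_lt (n := n) h; omega
      · rw [itemDeath_of_lt hk'] at h2
        omega
    · rw [itemDeath_of_lt hk] at h1 h2
      rcases hquery j j' i i' h1 h2 with h | ⟨rfl, h⟩
      · have := mul_add_le_of_lt (n := n) h; omega
      · rcases lt_trichotomy i' i with h3 | h3 | h3
        · rw [Fin.lt_def] at h3; omega
        · subst h3; exact le_rfl
        · rcases h with h | h
          · exact absurd (h3.trans_le h) (not_lt.2 hk.le)
          · exact absurd h3 (not_lt.2 h)
  -- no alive item exceeds a checked value; only here the blocks have to be good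
  · rintro σ - c h ⟨j', i'⟩ h1 h2
    have htop : itemValue U ξ (j', i') ≤ clampItem U (2 * (m * n)) := by
      rw [itemValue, clampItem_le_iff (hval _ _) hU]
      have := mul_add_le (n := n) j'
      have := i'.2
      have := toNat_le_one ((ξ j').x i')
      simp only; omega
    rcases slot_index_cases m n σ with ⟨j, i, rfl⟩ | ⟨j, i, rfl⟩ | ⟨j, i, rfl⟩ | h'
    · rw [hardSlot_birth] at h; cases h
    · rw [hardSlot_query] at h
      split_ifs at h with hk
      obtain rfl := Slot.check.inj h
      rw [itemValue, checkValue, clampItem_le_iff (hval _ _) (hchk _)]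
      have hi' := i'.2
      have b1 := toNat_le_one ((ξ j').x i')
      simp only
      rcases hquery j j' i i' h1 h2 with h | ⟨rfl, h⟩
      · have := mul_add_le_of_lt (n := n) h; omega
      · have h3 : i' ≤ (ξ j').k := by
          rcases h with h | h
          · exact h
          · exact h.trans (not_lt.1 hk)
        rcases h3.lt_or_eq with h4 | h4
        · rw [Fin.lt_def] at h4; omega
        · have := hξ j'
          rw [Block.Good, ← h4] at this
          rw [← h4]
          cases hz : (ξ j').z <;> cases hx : (ξ j').x i' <;> simp_all
    · rw [hardSlot_tail] at h
      split_ifs at h with hk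
      obtain rfl := Slot.check.inj h
      exact htop
    · rw [hardSlot_of_le _ _ h'] at h
      obtain rfl := Slot.check.inj h
      exact htop

theorem hardWord_not_mem {U N : ℕ} (hmn : 6 * (m * n) ≤ N) (hU : 2 * (m * n) ≤ U)
    {ξ : Fin m → Block n} {j : Fin m} (hξ : ¬ (ξ j).Good) : hardWord U N ξ ∉ PQTS U N := by
  intro hw
  -- the copies of the tested letter are present at the first check of block `j`, in the slot of `k`
  rw [Block.Good, not_not] at hξ
  obtain ⟨hz, hx⟩ := hξ
  set k := (ξ j).k with hk
  have hj := mul_add_le (n := n) j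
  have hkn := k.2
  set t₀ : ℕ := 2 * (2 * (n * j) + k) with ht₀
  set t₁ : ℕ := 2 * (2 * (n * j) + (2 * n - 1 - k)) + 1 with ht₁
  have ht₀N : t₀ < N := by omega
  have ht₁N : t₁ < N := by omega
  have e0 : t₀ / 2 = 2 * (n * j) + k := by omega
  have e1 : t₁ / 2 = 2 * (n * j) + (2 * n - 1 - k) := by omega
  have e1' : t₁ % 2 = 1 := by omega
  have hins : (hardWord U N ξ ⟨t₀, ht₀N⟩).1 = Op.ins (clampItem U (2 * (n * j + k) + 1)) := by
    simp only [hardWord, e0, hardSlot_birth, Slot.letter, itemValue, hx, Bool.toNat_true]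
  have hext : (hardWord U N ξ ⟨t₁, ht₁N⟩).1 = Op.ext (clampItem U (2 * (n * j + k))) := by
    simp only [hardWord, e1, hardSlot_query, ← hk, lt_irrefl, if_false, Slot.letter, e1',
      one_ne_zero, checkValue, hz, Bool.not_true, Bool.toNat_false, add_zero]
  have hmem : clampItem U (2 * (n * j + k) + 1) ∈ contents (fun i => (hardWord U N ξ i).1) t₁ := by
    refine mem_contents_of_ins ht₀N hins (by omega) fun l hl h1 h2 h => ?_
    simp only [hardWord] at h
    have hi0 : 2 * (n * j) + k ≤ l / 2 := by omega
    have hi1 : l / 2 ≤ 2 * (n * j) + (2 * n - 1 - k) := by omega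
    rcases slot_index_cases m n (l / 2) with ⟨j', i', e⟩ | ⟨j', i', e⟩ | ⟨j', i', e⟩ | e
    · rw [e, hardSlot_birth] at h
      simp [Slot.letter] at h
    · have hi' := i'.2
      have hjj : j' = j := by
        rcases lt_trichotomy j' j with h3 | h3 | h3
        · have := mul_add_le_of_lt (n := n) h3; omega
        · exact h3
        · have := mul_add_le_of_lt (n := n) h3; omega
      subst hjj
      rw [e, hardSlot_query, ← hk] at h
      split_ifs at h with h3
      · simp only [Slot.letter, Op.ext.injEq, itemValue] at h
        have := toNat_le_one ((ξ j').x i')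
        rw [clampItem_inj (by omega) (by omega)] at h
        rw [Fin.lt_def] at h3
        omega
      · simp only [Slot.letter] at h
        split_ifs at h with h4
        simp only [Op.ext.injEq, checkValue, hz, Bool.not_true, Bool.toNat_false, add_zero,
          ← hk] at h
        rw [clampItem_inj (by omega) (by omega)] at h
        omega
    · have := mul_add_le (n := n) j'
      have := i'.2
      omega
    · omega
  have := (hw.2.1.2 ⟨t₁, ht₁N⟩ _ hext).2 hmem
  rw [clampItem_le_iff (by omega) (by omega)] at this
  omega

/-- The first half of block `j` depends on the string of the block only. -/
lemma hardWord_feed_congr {U N : ℕ} {ξ ξ' : Fin m → Block n} {j : Fin m}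
    (h : (ξ j).x = (ξ' j).x) {t : ℕ} (ht : t < N) (h1 : 4 * (n * j) ≤ t)
    (h2 : t < 4 * (n * j) + 2 * n) : hardWord U N ξ ⟨t, ht⟩ = hardWord U N ξ' ⟨t, ht⟩ := by
  have e : t / 2 = 2 * (n * j) + (⟨t / 2 - 2 * (n * j), by omega⟩ : Fin n) := by
    simp only; omega
  simp only [hardWord]
  rw [e, hardSlot_birth, hardSlot_birth]
  simp only [Slot.letter, itemValue, h]

/-- The second half of block `j` depends on the position, the check bit, and the string after the
position. -/
lemma hardWord_query_congr {U N : ℕ} {ξ ξ' : Fin m → Block n} {j : Fin m}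
    (hk : (ξ j).k = (ξ' j).k) (hz : (ξ j).z = (ξ' j).z)
    (hx : ∀ i, (ξ j).k < i → (ξ j).x i = (ξ' j).x i) {t : ℕ} (ht : t < N)
    (h1 : 4 * (n * j) + 2 * n ≤ t) (h2 : t < 4 * (n * j) + 4 * n) :
    hardWord U N ξ ⟨t, ht⟩ = hardWord U N ξ' ⟨t, ht⟩ := by
  obtain ⟨i, hi⟩ : ∃ i : Fin n, t / 2 = 2 * (n * j) + (2 * n - 1 - i) :=
    ⟨⟨2 * n - 1 - (t / 2 - 2 * (n * j)), by omega⟩, by simp only; omega⟩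
  simp only [hardWord]
  rw [hi, hardSlot_query, hardSlot_query, ← hk]
  split_ifs with h
  · simp only [Slot.letter, itemValue, hx i h]
  · simp only [Slot.letter, checkValue, hk, hz]

/-- After the blocks, the word depends on the positions and the strings up to the positions. -/
lemma hardWord_tail_congr {U N : ℕ} {ξ ξ' : Fin m → Block n}
    (hk : ∀ j, (ξ j).k = (ξ' j).k) (hx : ∀ j, ∀ i ≤ (ξ j).k, (ξ j).x i = (ξ' j).x i)
    {t : ℕ} (ht : t < N) (h1 : 4 * (m * n) ≤ t) :
    hardWord U N ξ ⟨t, ht⟩ = hardWord U N ξ' ⟨t, ht⟩ := by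
  simp only [hardWord]
  rcases slot_index_cases m n (t / 2) with ⟨j', i', e⟩ | ⟨j', i', e⟩ | ⟨j', i', e⟩ | e
  · have := mul_add_le (n := n) j'
    have := i'.2
    omega
  · have := mul_add_le (n := n) j'
    have := i'.2
    omega
  · rw [e, hardSlot_tail, hardSlot_tail, ← hk]
    split_ifs with h
    · simp only [Slot.letter, itemValue, hx j' i' h]
    · rfl
  · rw [hardSlot_of_le _ _ e, hardSlot_of_le _ _ e]
    rfl

end HardWords

/-! ### Streaming algorithms as block protocols -/

section Streaming

/-- A fold over `Fin n` is the last value of any sequence that follows the same recursion. -/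
lemma Fin.foldl_eq_of_step {α : Type*} {n : ℕ} {f : α → Fin n → α} {x : α} (g : ℕ → α)
    (h0 : g 0 = x) (hs : ∀ i (h : i < n), g (i + 1) = f (g i) ⟨i, h⟩) : Fin.foldl n f x = g n := by
  induction n with
  | zero => rw [Fin.foldl_zero, h0]
  | succ n ih =>
    rw [Fin.foldl_succ_last, ih fun i h => hs i (by omega), hs n (by omega)]
    rfl

namespace StreamingAlgorithm

variable {A : Type} {N p s : ℕ} (M : StreamingAlgorithm A N p s)

/-- The memory after the letters at the positions `a, …, a + l - 1` have been read in pass `t`. -/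
def scan (w : Fin N → A) (t : Fin p) (a : ℕ) : ℕ → (Fin s → Bool) → (Fin s → Bool)
  | 0, q => q
  | l + 1, q =>
    if h : a + l < N then M.step t ⟨a + l, h⟩ (scan w t a l q) (w ⟨a + l, h⟩) else scan w t a l q

lemma scan_add (w : Fin N → A) (t : Fin p) (a l l' : ℕ) (q : Fin s → Bool) :
    M.scan w t a (l + l') q = M.scan w t (a + l) l' (M.scan w t a l q) := by
  induction l' with
  | zero => rfl
  | succ l' ih =>
    rw [← add_assoc]
    simp only [scan, ih, ← add_assoc]

lemma scan_congr {w w' : Fin N → A} (t : Fin p) {a l : ℕ} (q : Fin s → Bool)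
    (h : ∀ i (hi : i < N), a ≤ i → i < a + l → w ⟨i, hi⟩ = w' ⟨i, hi⟩) :
    M.scan w t a l q = M.scan w' t a l q := by
  induction l with
  | zero => rfl
  | succ l ih =>
    simp only [scan, ih fun i hi h1 h2 => h i hi h1 (by omega)]
    split_ifs with hl
    · rw [h _ hl (by omega) (by omega)]
    · rfl

lemma pass_eq_scan (w : Fin N → A) (t : Fin p) (q : Fin s → Bool) :
    M.pass w t q = M.scan w t 0 N q := by
  refine Fin.foldl_eq_of_step (fun l => M.scan w t 0 l q) rfl fun i h => ?_
  simp only [scan, zero_add, dif_pos h]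

/-- The memory after the first `t` passes. -/
def memory (w : Fin N → A) : ℕ → (Fin s → Bool)
  | 0 => M.start
  | t + 1 => if h : t < p then M.pass w ⟨t, h⟩ (memory w t) else memory w t

lemma memory_succ (w : Fin N → A) (t : Fin p) :
    M.memory w (t + 1) = M.pass w t (M.memory w t) := by
  rw [memory, dif_pos t.2]

lemma output_eq (w : Fin N → A) : M.output w = M.answer (M.memory w p) := by
  exact congrArg M.answer (Fin.foldl_eq_of_step (M.memory w) rfl fun i h => M.memory_succ w ⟨i, h⟩)

variable {m n : ℕ} {U : ℕ}

/-- The `p` passes over the hard words as one block protocol. A state is the tuple of the memories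
of the `p` passes at the same place of the word. A transcript `τ` consists of the memories `τ.1` of
the passes after the blocks and the memories `τ.2` at their ends. Under a guess `τ`, pass `t` starts
with the memory `τ.2 (t - 1)`, so that all passes run at once from left to right. In `feed`, which
sees the string only, position and check bit are filled in arbitrarily. -/
def blockProtocol (M : StreamingAlgorithm (StampedOp U) N p s) (m n : ℕ) (hn : 0 < n) :
    BlockProtocol m n (Fin p → Fin s → Bool)
      ((Fin p → Fin s → Bool) × (Fin p → Fin s → Bool)) where
  start τ t := if h : (t : ℕ) = 0 then M.start else τ.2 ⟨t - 1, by omega⟩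
  final τ := τ.1
  feed j q x t := M.scan (hardWord U N fun _ : Fin m => ⟨x, ⟨0, hn⟩, false⟩) t (4 * (n * j))
    (2 * n) (q t)
  query j q b t := M.scan (hardWord U N fun _ : Fin m => b) t (4 * (n * j) + 2 * n) (2 * n) (q t)
  query_congr j q b b' hk hz hx := by
    funext t
    exact M.scan_congr t _ fun i hi h1 h2 =>
      hardWord_query_congr (j := j) hk hz hx hi h1 (by omega)
  tail τ ξ := ∀ t, M.scan (hardWord U N ξ) t (4 * (m * n)) (N - 4 * (m * n)) (τ.1 t) = τ.2 t
  tail_congr τ ξ ξ' hk hx h t := by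
    rw [← h t]
    exact (M.scan_congr t _ fun i hi h1 _ => hardWord_tail_congr hk hx hi h1).symm
  transcript ξ := (fun t => M.scan (hardWord U N ξ) t 0 (4 * (m * n))
      (M.memory (hardWord U N ξ) t),
    fun t => M.memory (hardWord U N ξ) (t + 1))

/-- The state after `i` blocks holds the memories after `4ni` letters. -/
lemma blockProtocol_state (M : StreamingAlgorithm (StampedOp U) N p s) (hn : 0 < n)
    (τ : (Fin p → Fin s → Bool) × (Fin p → Fin s → Bool)) (ξ : Fin m → Block n) {i : ℕ}
    (hi : i ≤ m) : (M.blockProtocol m n hn).state τ ξ i = fun t =>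
      M.scan (hardWord U N ξ) t 0 (4 * (n * i)) ((M.blockProtocol m n hn).start τ t) := by
  induction i with
  | zero => rfl
  | succ i ih =>
    rw [(M.blockProtocol m n hn).state_succ τ ξ ⟨i, hi⟩, BlockProtocol.mid]
    simp only [ih (by omega)]
    funext t
    have e : 4 * (n * (i + 1)) = 4 * (n * i) + (2 * n + 2 * n) := by ring
    rw [e, M.scan_add _ _ _ _ _ _, M.scan_add, zero_add]
    simp only [blockProtocol]
    rw [M.scan_congr t _ fun l hl h1 h2 => hardWord_query_congr (U := U) (j := ⟨i, hi⟩)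
      (ξ := fun _ => ξ ⟨i, hi⟩) (ξ' := ξ) rfl rfl (fun _ _ => rfl) hl h1
        (by simp only at h2 ⊢; omega)]
    congr 1
    exact M.scan_congr t _ fun l hl h1 h2 => hardWord_feed_congr (U := U) (j := ⟨i, hi⟩)
      (ξ := fun _ => ⟨(ξ ⟨i, hi⟩).x, ⟨0, hn⟩, false⟩) (ξ' := ξ) rfl hl h1 h2

/-- If a guess is confirmed, it is the true transcript: by induction on the passes, the guessed
start of each pass is the true one. -/
lemma blockProtocol_isExact (M : StreamingAlgorithm (StampedOp U) N p s) (hn : 0 < n)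
    (hN : 4 * (m * n) ≤ N) : (M.blockProtocol m n hn).IsExact := by
  intro ξ τ
  rw [blockProtocol_state M hn τ ξ le_rfl, mul_comm n m]
  have hpass : ∀ t (q : Fin s → Bool), M.pass (hardWord U N ξ) t q =
      M.scan (hardWord U N ξ) t (4 * (m * n)) (N - 4 * (m * n))
        (M.scan (hardWord U N ξ) t 0 (4 * (m * n)) q) := by
    intro t q
    have := M.scan_add (hardWord U N ξ) t 0 (4 * (m * n)) (N - 4 * (m * n)) q
    rwa [Nat.add_sub_cancel' hN, zero_add, ← pass_eq_scan] at this
  constructor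
  · rintro rfl
    have hstart : ∀ t : Fin p, (M.blockProtocol m n hn).start
        ((M.blockProtocol m n hn).transcript ξ) t = M.memory (hardWord U N ξ) t := by
      intro t
      simp only [blockProtocol]
      split_ifs with h
      · rw [h]; rfl
      · rw [Nat.sub_add_cancel (by omega)]
    refine ⟨?_, fun t => ?_⟩
    · funext t
      rw [hstart]
      rfl
    · simp only [blockProtocol]
      rw [memory_succ, hpass]
  · rintro ⟨h1, h2⟩
    have h2 : ∀ t, M.scan (hardWord U N ξ) t (4 * (m * n)) (N - 4 * (m * n)) (τ.1 t) = τ.2 t := h2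
    have key : ∀ t (ht : t < p),
        (M.blockProtocol m n hn).start τ ⟨t, ht⟩ = M.memory (hardWord U N ξ) t ∧
        M.memory (hardWord U N ξ) (t + 1) = τ.2 ⟨t, ht⟩ := by
      intro t
      induction t with
      | zero =>
        intro ht
        have hs : (M.blockProtocol m n hn).start τ ⟨0, ht⟩ = M.memory (hardWord U N ξ) 0 := rfl
        refine ⟨hs, ?_⟩
        rw [M.memory_succ _ ⟨0, ht⟩, hpass, ← h2]
        congr 1
        exact (congrArg _ hs.symm).trans (congrFun h1 _)
      | succ t ih =>
        intro ht
        have hs : (M.blockProtocol m n hn).start τ ⟨t + 1, ht⟩ =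
            M.memory (hardWord U N ξ) (t + 1) := by
          rw [(ih (by omega)).2]
          rfl
        refine ⟨hs, ?_⟩
        rw [M.memory_succ _ ⟨t + 1, ht⟩, hpass, ← h2]
        congr 1
        exact (congrArg _ hs.symm).trans (congrFun h1 _)
    refine Prod.ext ?_ ?_
    · funext t
      rw [← show (fun t => M.scan (hardWord U N ξ) t 0 (4 * (m * n))
        ((M.blockProtocol m n hn).start τ t)) = τ.1 from h1]
      simp only [(key t t.2).1]
      rfl
    · funext t
      exact (key t t.2).2

end StreamingAlgorithm

namespace RandomizedStreamingAlgorithm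

variable {A : Type} {N p s : ℕ} {Ω : Type*} [MeasurableSpace Ω]

open scoped Classical in
/-- Fixing the coins: the error over a finite family of inputs is at most `ε` on average. -/
lemma Recognizes.exists_coins {R : RandomizedStreamingAlgorithm A N p s Ω} {L : Set (Fin N → A)}
    {ε : ℝ} (hR : R.Recognizes L ε) {ι : Type*} (T : Finset ι) (w : ι → Fin N → A) :
    ∃ ω, ∑ i ∈ T, (if ((R.alg ω).output (w i) = true ↔ w i ∈ L) then 0 else 1 : ℝ) ≤
      ε * T.card := by
  set μ : Measure Ω := (R.coins : Measure Ω)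
  have hm : ∀ i, MeasurableSet {ω | ¬ ((R.alg ω).output (w i) = true ↔ w i ∈ L)} := fun i =>
    R.measurable_output (w i) (MeasurableSet.of_discrete (s := {b | ¬ (b = true ↔ w i ∈ L)}))
  have hf : ∀ i ω, (if ((R.alg ω).output (w i) = true ↔ w i ∈ L) then 0 else 1 : ℝ) =
      Set.indicator {ω | ¬ ((R.alg ω).output (w i) = true ↔ w i ∈ L)} 1 ω := by
    intro i ω
    by_cases h : ((R.alg ω).output (w i) = true ↔ w i ∈ L) <;> simp [h]
  have hint : ∀ i, Integrable
      (Set.indicator {ω | ¬ ((R.alg ω).output (w i) = true ↔ w i ∈ L)} (1 : Ω → ℝ)) μ := fun i =>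
    (integrable_const (1 : ℝ)).indicator (hm i)
  obtain ⟨ω, hω⟩ := exists_le_integral (μ := μ) (f := fun ω => ∑ i ∈ T,
    Set.indicator {ω | ¬ ((R.alg ω).output (w i) = true ↔ w i ∈ L)} (1 : Ω → ℝ) ω)
    (integrable_finsetSum _ fun i _ => hint i)
  refine ⟨ω, ?_⟩
  simp only [hf]
  refine hω.trans ?_
  rw [integral_finsetSum _ fun i _ => hint i]
  refine (Finset.sum_le_card_nsmul _ _ ε fun i _ => ?_).trans_eq (by rw [nsmul_eq_mul, mul_comm])
  rw [integral_indicator_one (hm i)]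
  exact hR (w i)

/-- Without memory the answer does not depend on the input. -/
lemma Recognizes.memory_ne_zero {R : RandomizedStreamingAlgorithm A N p s Ω}
    {L : Set (Fin N → A)} (hR : R.Recognizes L (1 / 3)) {w w' : Fin N → A} (hw : w ∈ L)
    (hw' : w' ∉ L) : s ≠ 0 := by
  rintro rfl
  obtain ⟨ω, hω⟩ := hR.exists_coins (Finset.univ : Finset Bool) fun b => if b then w else w'
  have h : (R.alg ω).output w = (R.alg ω).output w' :=
    congrArg (R.alg ω).answer (Subsingleton.elim _ _)
  simp only [Fintype.sum_bool, if_true, Bool.false_eq_true, if_false, hw, hw', h, iff_true,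
    iff_false, Finset.card_univ, Fintype.card_bool] at hω
  cases hb : (R.alg ω).output w' <;> norm_num [hb] at hω

end RandomizedStreamingAlgorithm

/-! ### The lower bound -/

open Finset in
/-- The memory bound for `n` blocks of length `n`. The transcripts number `2 ^ (2ps)` and the states
`2 ^ (ps)`, so that `blocks_le` yields `n ≤ (2 * 2592 + 7776) * ps * log 2`. -/
lemma side_le_of_recognizes {N p s : ℕ} {U : ℕ} {Ω : Type*} [MeasurableSpace Ω]
    {R : RandomizedStreamingAlgorithm (StampedOp U) N p s Ω} (hR : R.Recognizes (PQTS U N) (1 / 3))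
    (hN : Even N) (hp : 1 ≤ p) {n : ℕ} (hn : 0 < n) (hnN : 6 * (n * n) ≤ N)
    (hU : 2 * (n * n) ≤ U) : (n : ℝ) ≤ 12960 * (p * s) := by
  classical
  -- coins with average error at most `1 / 3` on the classes `(0, 0)` and `(1, 1)` of all blocks
  obtain ⟨ω, hω⟩ := hR.exists_coins
    ((univ : Finset (Fin n × Bool)).sigma fun q => inputClass (n := n) q.1 q.2 q.2)
    fun q => hardWord U N q.2
  set M := R.alg ω
  set P := M.blockProtocol n n hn
  obtain ⟨acc, hacc⟩ : ∃ acc : (Fin p → Fin s → Bool) × (Fin p → Fin s → Bool) → Prop,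
      acc = fun τ => M.answer (τ.2 ⟨p - 1, by omega⟩) = true := ⟨_, rfl⟩
  have hout : ∀ ξ, acc (P.transcript ξ) ↔ M.output (hardWord U N ξ) = true := by
    intro ξ
    rw [M.output_eq, hacc]
    simp only [P, StreamingAlgorithm.blockProtocol, Nat.sub_add_cancel hp]
  have h0 : ∀ j : Fin n, ∑ ξ ∈ inputClass (n := n) j false false,
      (if (M.output (hardWord U N ξ) = true ↔ hardWord U N ξ ∈ PQTS U N) then 0 else 1 : ℝ) =
      #(inputClass (n := n) j false false) -
        #{ξ ∈ inputClass (n := n) j false false | acc (P.transcript ξ)} := by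
    intro j
    rw [← sum_boole, card_eq_sum_ones, Nat.cast_sum, ← sum_sub_distrib]
    refine sum_congr rfl fun ξ hξ => ?_
    have hmem := hardWord_mem (U := U) hN hnN hU
      (mem_validInputs.1 (inputClass_subset (by simp) hξ))
    simp only [hout, hmem, iff_true]
    split_ifs <;> simp
  have h1 : ∀ j : Fin n, ∑ ξ ∈ inputClass (n := n) j true true,
      (if (M.output (hardWord U N ξ) = true ↔ hardWord U N ξ ∈ PQTS U N) then 0 else 1 : ℝ) =
        #{ξ ∈ inputClass (n := n) j true true | acc (P.transcript ξ)} := by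
    intro j
    rw [← sum_boole]
    refine sum_congr rfl fun ξ hξ => ?_
    have hmem := hardWord_not_mem (U := U) (ξ := ξ) (j := j) hnN hU
      (not_not.2 ⟨(mem_inputClass.1 hξ).2.2, (mem_inputClass.1 hξ).2.1⟩)
    simp only [hout, hmem, iff_false]
    split_ifs <;> simp_all
  rw [sum_sigma, Fintype.sum_prod_type, card_sigma, Fintype.sum_prod_type] at hω
  simp only [Fintype.sum_bool, h0, h1, card_inputClass _ true true false false] at hω
  push_cast at hω
  simp only [sum_add_distrib, sum_sub_distrib] at hω
  have h := P.blocks_le (StreamingAlgorithm.blockProtocol_isExact M hn (by omega)) hn acc (by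
    rw [sum_sub_distrib]; linarith)
  have hn' : (0 : ℝ) < n := by exact_mod_cast hn
  have hlog : Real.log (Fintype.card (Fin p → Fin s → Bool)) = p * s * Real.log 2 := by
    simp only [Fintype.card_fun, Fintype.card_fin, Fintype.card_bool]
    push_cast
    rw [Real.log_pow, Real.log_pow]; ring
  rw [Fintype.card_prod, Nat.cast_mul, Real.log_mul (by positivity) (by positivity), hlog,
    mul_assoc 7776, mul_comm (n : ℝ), ← mul_assoc, mul_div_assoc, div_self hn'.ne', mul_one] at h
  have hlog2 : Real.log 2 ≤ 1 := by linarith [Real.log_two_lt_d9]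
  have hps : (p : ℝ) * s * Real.log 2 ≤ p * s * 1 := by gcongr
  linarith

end Streaming

theorem theorem1 :
    ∃ c : ℝ, 0 < c ∧
      ∀ (N p s : ℕ), Even N → 1 ≤ p →
        ∀ (Ω : Type*) [MeasurableSpace Ω]
          (R : RandomizedStreamingAlgorithm (StampedOp (3 * N / 2)) N p s Ω),
          R.Recognizes (PQTS (3 * N / 2) N) (1 / 3) →
            c * (Real.sqrt N / p) ≤ s := by
  refine ⟨1 / 64800, by norm_num, fun N p s hN hp Ω _ R hR => ?_⟩
  have hp' : (1 : ℝ) ≤ p := by exact_mod_cast hp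
  rcases Nat.eq_zero_or_pos N with rfl | hN0
  · simp
  suffices h : √(N : ℝ) ≤ 64800 * (p * s) by
    rw [← mul_div_assoc, div_le_iff₀ (by linarith)]
    linarith
  -- for `N < 6` the hard words have no blocks, and it is enough that some memory is needed
  rcases lt_or_ge N 6 with hN6 | hN6
  · have hs : s ≠ 0 := by
      refine hR.memory_ne_zero (w := hardWord (m := 0) (n := 0) _ N Fin.elim0)
        (w' := fun _ => (Op.ext 0, 0)) (hardWord_mem hN (by simp) (by simp) fun j => j.elim0) ?_
      intro h
      have := h.2.1.1.2 ⟨0, hN0⟩ 0 rfl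
      simp [contents] at this
    have hs' : (1 : ℝ) ≤ s := by exact_mod_cast Nat.one_le_iff_ne_zero.2 hs
    have hNR : (N : ℝ) < 6 := by exact_mod_cast hN6
    have h3 : √(N : ℝ) ≤ 3 := Real.sqrt_le_iff.2 ⟨by norm_num, by linarith⟩
    nlinarith
  · set n := Nat.sqrt (N / 6) with hn
    have h1 : n * n ≤ N / 6 := Nat.sqrt_le _
    have h2 : N / 6 < (n + 1) * (n + 1) := Nat.lt_succ_sqrt _
    have hn0 : 0 < n := Nat.sqrt_pos.2 (by omega)
    have h := side_le_of_recognizes hR hN hp hn0 (by omega) (by omega)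
    have h3 : √(N : ℝ) ≤ 5 * n := by
      refine Real.sqrt_le_iff.2 ⟨by positivity, ?_⟩
      have : N ≤ 25 * (n * n) := by
        nlinarith [Nat.div_add_mod N 6, Nat.mod_lt N (show 6 > 0 by omega)]
      have h4 : (N : ℝ) ≤ 25 * (n * n) := by exact_mod_cast this
      linarith
    linarith
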